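/- Let $k\in\mathbb N$, let $\mu$ be the standard Gaussian measure on $\mathbb R^k$, and let $f\in L^p(\mathbb R^k,\mu)$ for some real $p>1$. For $n\in\mathbb N$ let $S^{n-1}(\sqrt n)\subseteq\mathbb R^n$ be the sphere of radius $\sqrt n$ centred at the origin, with its rotation-invariant Borel probability measure $\bar\sigma_n$ (normalized surface area). View $f$ as a function on $\mathbb R^n$, $n\ge k$, by composing it with the projection to the first $k$ coordinates. Fix any $\aleph_1$-saturated nonstandard extension ${}^*$ of the standard universe. For $N\in{}^*\mathbb N\setminus\mathbb N$ (written $N>\mathbb N$), let $(S^{N-1}(\sqrt N),\mathcal F_N,\bar\sigma_N)$ be the $N$-th term of the nonstandard extension of the sequence of probability spaces $(S^{n-1}(\sqrt n),\mathcal B(S^{n-1}(\sqrt n)),\bar\sigma_n)$, and let $L\bar\sigma_N$ be the Loeb measure of $\bar\sigma_N$, that is, the complete measure obtained from the finitely additive measure $\operatorname{st}\circ\bar\sigma_N$ on $\mathcal F_N$ by Carathéodory extension. Then: 1. For every $N>\mathbb N$ the function ${}^*f$ is $S$-integrable on $S^{N-1}(\sqrt N)$. That is, ${}^*f$ is ${}^*$-integrable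 over $(S^{N-1}(\sqrt N),\bar\sigma_N)$ and finite $L\bar\sigma_N$-almost everywhere, the ${}^*$-integral of $|{}^*f|$ over $S^{N-1}(\sqrt N)$ is finite, and for every $B\in\mathcal F_N$ with $\bar\sigma_N(B)\approx 0$ the ${}^*$-integral of $|{}^*f|$ over $B$ is infinitesimal. 2. The function $f$ is integrable on $(S^{n-1}(\sqrt n),\bar\sigma_n)$ for all large $n\in\mathbb N$, and $$\lim_{m\to\infty}\lim_{n\to\infty}\int_{S^{n-1}(\sqrt n)\cap\{|f|\ge m\}}|f|\,d\bar\sigma_n=0,$$ where the inner limit exists for every $m\in\mathbb N$. 3. $$\lim_{n\to\infty}\int_{S^{n-1}(\sqrt n)}f\,d\bar\sigma_n=\int_{\mathbb R^k}f\,d\mu .$$ 4. For every $N>\mathbb N$ the function $\operatorname{st}({}^*f)$ is $L\bar\sigma_N$-integrable on $S^{N-1}(\sqrt N)$, and the limit in 3 equals $$\int_{S^{N-1}(\sqrt N)}\operatorname{st}({}^*f)\,dL\bar\sigma_N .$$ -/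

import Mathlib

open MeasureTheory ProbabilityTheory Filter Topology Metric

universe u v

/-! ### Many-sorted first-order formulas and the transfer principle -/

/-- Tuples of elements of the interpretations `I A` of the sorts `A` in a list. -/
def SortTuple (I : Type → Type v) : List Type → Type v
  | [] => PUnit
  | A :: Γ => I A × SortTuple I Γ

namespace SortTuple

/-- Apply a sort-indexed family of maps to every entry of a tuple. -/
def map {I : Type → Type u} {J : Type → Type v} (g : ∀ A, I A → J A) :
    ∀ {Γ : List Type}, SortTuple I Γ → SortTuple J Γ
  | [], _ => PUnit.unit
  | A :: _, e => (g A e.1, map g e.2)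

end SortTuple

/-- `SortVar Γ A`: the variables of sort `A` in the context `Γ`. -/
inductive SortVar : List Type → Type → Type 1
  | zero {A : Type} {Γ : List Type} : SortVar (A :: Γ) A
  | succ {A B : Type} {Γ : List Type} : SortVar Γ A → SortVar (B :: Γ) A

/-- The value of a variable under an assignment. -/
def SortVar.val {I : Type → Type v} {A : Type} :
    ∀ {Γ : List Type}, SortVar Γ A → SortTuple I Γ → I A
  | _, .zero, e => e.1
  | _, .succ x, e => x.val e.2

/-- A relation of sort `Γ`: a set of tuples. -/
abbrev SortRel (Γ : List Type) : Type := SortTuple (fun A => A) Γ → Prop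

/-- First-order formulas with free variables in `Γ`. Every relation between standard sets is
allowed as a relation symbol; every quantifier ranges over a standard set (such as `ℕ`, `ℝ`, or
the set `Set A` of all subsets of `A`). -/
inductive SortFormula : List Type → Type 1
  | eq {Γ : List Type} {A : Type} (x y : SortVar Γ A) : SortFormula Γ
  | rel {Γ Δ : List Type} (R : SortRel Δ) (x : SortTuple (SortVar Γ) Δ) : SortFormula Γ
  | neg {Γ : List Type} (φ : SortFormula Γ) : SortFormula Γ
  | and {Γ : List Type} (φ ψ : SortFormula Γ) : SortFormula Γ
  | all {Γ : List Type} (A : Type) (φ : SortFormula (A :: Γ)) : SortFormula Γ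

/-- Satisfaction of a formula, when the sort `A` is interpreted by `I A` and the relation
symbol `R` by `rel R`. Equality is interpreted as equality. -/
def SortFormula.Holds (I : Type → Type v)
    (rel : ∀ {Δ : List Type}, SortRel Δ → SortTuple I Δ → Prop) :
    ∀ {Γ : List Type}, SortFormula Γ → SortTuple I Γ → Prop
  | _, .eq x y, e => x.val e = y.val e
  | _, .rel R x, e => rel R (x.map fun _ y => y.val e)
  | _, .neg φ, e => ¬ φ.Holds I rel e
  | _, .and φ ψ, e => φ.Holds I rel e ∧ ψ.Holds I rel e
  | _, .all A φ, e => ∀ a : I A, φ.Holds I rel (a, e)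

/-- A nonstandard extension of the standard universe: every set `A` has an extension `*A`
containing (a copy of) `A`, every relation `R` between sets has an extension `*R`, the transfer
principle holds, and infinite sets are properly extended. -/
structure NonstandardExtension where
  /-- the extension `*A` of the set `A` -/
  star : Type → Type u
  /-- the embedding of `A` in `*A` -/
  incl : ∀ {A : Type}, A → star A
  /-- the extension `*R` of the relation `R` -/
  starRel : ∀ {Γ : List Type}, SortRel Γ → SortTuple star Γ → Prop
  /-- the transfer principle: a formula holds of standard parameters if and only if its
  `*`-transform holds of them -/
  transfer : ∀ {Γ : List Type} (φ : SortFormula Γ) (e : SortTuple (fun A => A) Γ),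
    φ.Holds (fun A => A) (fun R => R) e ↔ φ.Holds star starRel (e.map fun _ => incl)
  /-- `A` is a proper subset of `*A` for every infinite set `A` -/
  proper : ∀ A : Type, Infinite A → ¬ Function.Surjective (incl : A → star A)

namespace NonstandardExtension

variable (𝔘 : NonstandardExtension.{u})

/-- The extension `*S ⊆ *A` of a set `S ⊆ A`. -/
def starSet {A : Type} (S : Set A) : Set (𝔘.star A) :=
  {x | 𝔘.starRel (Γ := [A]) (fun e => e.1 ∈ S) (x, PUnit.unit)}

/-- The extension of a binary relation. -/
def starRel₂ {A B : Type} (R : A → B → Prop) (x : 𝔘.star A) (y : 𝔘.star B) : Prop :=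
  𝔘.starRel (Γ := [A, B]) (fun e => R e.1 e.2.1) (x, y, PUnit.unit)

/-- The extension of the graph of a function is the graph of a function. -/
theorem existsUnique_starRel₂_graph {A B : Type} (f : A → B) (x : 𝔘.star A) :
    ∃! y : 𝔘.star B, 𝔘.starRel₂ (fun a b => f a = b) x y := by
  let G : SortRel [A, B] := fun e => f e.1 = e.2.1
  have h₁ := 𝔘.transfer (Γ := []) (.all A (.neg (.all B (.neg
    (.rel (Δ := [A, B]) G (.succ .zero, .zero, PUnit.unit)))))) PUnit.unit
  have h₂ := 𝔘.transfer (Γ := []) (.all A (.all B (.all B (.neg (.and (.and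
    (.rel (Δ := [A, B]) G (.succ (.succ .zero), .succ .zero, PUnit.unit))
    (.rel (Δ := [A, B]) G (.succ (.succ .zero), .zero, PUnit.unit)))
    (.neg (.eq (.succ .zero) .zero))))))) PUnit.unit
  simp only [SortFormula.Holds, SortVar.val, SortTuple.map, G, not_and, not_not] at h₁ h₂
  have h₁' := h₁.1 (fun a h => h (f a) rfl) x
  have h₂' := h₂.1 (fun a b c h => h.1.symm.trans h.2) x
  push Not at h₁'
  obtain ⟨y, hy⟩ := h₁'
  exact ⟨y, hy, fun z hz => h₂' z y ⟨hz, hy⟩⟩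

/-- The extension `*f : *A → *B` of a function `f : A → B`. -/
noncomputable def starMap {A B : Type} (f : A → B) (x : 𝔘.star A) : 𝔘.star B :=
  (𝔘.existsUnique_starRel₂_graph f x).choose

/-- The set of elements `x ∈ *A` with `x *∈ B`, where `B` is an element of `*𝒫(A)`. -/
def internalSet {A : Type} (B : 𝔘.star (Set A)) : Set (𝔘.star A) :=
  {x | 𝔘.starRel₂ (fun (a : A) (S : Set A) => a ∈ S) x B}

/-- Internal subsets of `*A`. -/
def IsInternal {A : Type} (S : Set (𝔘.star A)) : Prop :=
  ∃ B : 𝔘.star (Set A), 𝔘.internalSet B = S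

/-- `κ`-saturation: a collection of fewer than `κ` internal sets which has the finite
intersection property has non-empty intersection. -/
def IsSaturated (κ : Cardinal.{u}) : Prop :=
  ∀ (A : Type) (C : Set (Set (𝔘.star A))), (∀ S ∈ C, 𝔘.IsInternal S) → Cardinal.mk C < κ →
    (∀ D ⊆ C, D.Finite → (⋂₀ D).Nonempty) → (⋂₀ C).Nonempty

/-! ### Hyperfinite numbers and standard parts -/

/-- `N > ℕ`: the element `N` of `*ℕ` is larger than every standard natural number. -/
def IsHyperfinite (N : 𝔘.star ℕ) : Prop :=
  ∀ n : ℕ, N ∈ 𝔘.starSet {m : ℕ | n < m}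

/-- Finite hyperreals: `|x| ≤ r` for some standard real `r`. -/
def IsFinite (x : 𝔘.star ℝ) : Prop :=
  ∃ r : ℝ, x ∈ 𝔘.starSet {y : ℝ | |y| ≤ r}

/-- `x ≈ r` for a hyperreal `x` and a standard real `r`: `|x - r| < ε` for all standard
`ε > 0`. -/
def IsNear (x : 𝔘.star ℝ) (r : ℝ) : Prop :=
  ∀ ε : ℝ, 0 < ε → x ∈ 𝔘.starSet {y : ℝ | |y - r| < ε}

open Classical in
/-- The standard part of a hyperreal (`0` if the hyperreal is not finite). -/
noncomputable def st (x : 𝔘.star ℝ) : ℝ :=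
  if h : ∃ r : ℝ, 𝔘.IsNear x r then h.choose else 0

/-! ### The internal probability space at index `N` and its Loeb space -/

section Loeb

variable {Ω : ℕ → Type} [∀ n, MeasurableSpace (Ω n)] (ν : ∀ n, Measure (Ω n)) (N : 𝔘.star ℕ)

/-- The internal set `Ω_N`: the `N`-th term of the extension of the sequence `(Ω_n)` of sets,
that is, the fibre over `N` of the extension of the disjoint union of the `Ω_n`. -/
def Space (_ν : ∀ n, Measure (Ω n)) (N : 𝔘.star ℕ) : Type u :=
  {x : 𝔘.star (Σ n, Ω n) // 𝔘.starMap Sigma.fst x = N}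

/-- The internal algebra `𝓕_N`: the `N`-th term of the extension of the sequence of the
sigma-algebras of the `Ω_n`. -/
def Event (_ν : ∀ n, Measure (Ω n)) (N : 𝔘.star ℕ) : Type u :=
  {B : 𝔘.star (Σ n, {B : Set (Ω n) // MeasurableSet B}) // 𝔘.starMap Sigma.fst B = N}

variable {ν N} in
/-- An element of the internal algebra, as a set of points of `Ω_N`. -/
def Event.toSet (B : 𝔘.Event ν N) : Set (𝔘.Space ν N) :=
  {x | 𝔘.starRel₂ (fun (a : Σ n, Ω n) (S : Σ n, {S : Set (Ω n) // MeasurableSet S}) =>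
    ∃ (n : ℕ) (ω : Ω n) (T : {T : Set (Ω n) // MeasurableSet T}),
      a = ⟨n, ω⟩ ∧ S = ⟨n, T⟩ ∧ ω ∈ T.1) x.1 B.1}

variable {ν N} in
/-- The internal measure `ν_N(B) ∈ *ℝ` of an element `B` of the internal algebra. -/
noncomputable def internalMeasure (B : 𝔘.Event ν N) : 𝔘.star ℝ :=
  𝔘.starMap (fun S : Σ n, {S : Set (Ω n) // MeasurableSet S} => (ν S.1).real S.2.1) B.1

/-- The outer measure induced by the finitely additive measure `st ∘ ν_N` on the internal
algebra (sets outside the algebra carry the value `∞` before countable covers are taken). -/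
noncomputable def loebOuter : OuterMeasure (𝔘.Space ν N) :=
  OuterMeasure.boundedBy fun S =>
    ⨅ (B : 𝔘.Event ν N) (_ : Event.toSet 𝔘 B = S), ENNReal.ofReal (𝔘.st (𝔘.internalMeasure B))

/-- The Loeb sigma-algebra `L(𝓕_N)`: the Carathéodory-measurable sets, which, the measure being
finite, form the completion of the sigma-algebra generated by the internal algebra. -/
noncomputable instance loebSpace : MeasurableSpace (𝔘.Space ν N) :=
  (𝔘.loebOuter ν N).caratheodory

/-- The Loeb measure `Lν_N`. -/
noncomputable def loebMeasure : Measure (𝔘.Space ν N) :=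
  (𝔘.loebOuter ν N).toMeasure le_rfl

/-- The internal function `*f : Ω_N → *ℝ` given by a sequence of functions `f_n : Ω_n → ℝ`. -/
noncomputable def starFun (f : ∀ n, Ω n → ℝ) (x : 𝔘.Space ν N) : 𝔘.star ℝ :=
  𝔘.starMap (fun a : Σ n, Ω n => f a.1 a.2) x.1

variable {N} in
/-- The `*`-integral of `|*f|` over an element `B` of the internal algebra. -/
noncomputable def starIntegralAbs (f : ∀ n, Ω n → ℝ) (B : 𝔘.Event ν N) : 𝔘.star ℝ :=
  𝔘.starMap (fun S : Σ n, {S : Set (Ω n) // MeasurableSet S} =>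
    ∫ ω in S.2.1, |f S.1 ω| ∂(ν S.1)) B.1

/-- `S`-integrability over `Ω_N` of the internal function `*f` given by a sequence of functions
`f_n : Ω_n → ℝ`: it is `*`-integrable, finite Loeb-almost everywhere, the `*`-integral of its
absolute value is finite, and this integral is infinitesimal over every element of the internal
algebra of infinitesimal measure. -/
structure SIntegrable (f : ∀ n, Ω n → ℝ) : Prop where
  starIntegrable : N ∈ 𝔘.starSet {n : ℕ | Integrable (f n) (ν n)}
  ae_finite : ∀ᵐ x ∂(𝔘.loebMeasure ν N), 𝔘.IsFinite (𝔘.starFun ν N f x)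
  finite_integral : 𝔘.IsFinite (𝔘.starMap (fun n : ℕ => ∫ ω, |f n ω| ∂(ν n)) N)
  near_zero : ∀ B : 𝔘.Event ν N, 𝔘.IsNear (𝔘.internalMeasure B) 0 →
    𝔘.IsNear (𝔘.starIntegralAbs ν f B) 0

end Loeb

end NonstandardExtension

/-! ### Spheres -/

/-- The sphere `S^{n-1}(√n)` of radius `√n` and centre `0` in `ℝⁿ`. -/
abbrev RootSphere (n : ℕ) : Type := sphere (0 : EuclideanSpace ℝ (Fin n)) (√(n : ℝ))

/-- The dilation of the unit sphere of `ℝⁿ` onto `S^{n-1}(√n)`. -/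
noncomputable def dilateSphere (n : ℕ) (x : sphere (0 : EuclideanSpace ℝ (Fin n)) 1) :
    RootSphere n :=
  ⟨√(n : ℝ) • (x : EuclideanSpace ℝ (Fin n)), by simp [norm_smul]⟩

/-- The uniform probability measure `σ̄_n` on `S^{n-1}(√n)`: the surface measure of the unit
sphere, normalized and dilated. (For `n = 0` it is the zero measure.) -/
noncomputable def sphereMeasure (n : ℕ) : Measure (RootSphere n) :=
  (((volume : Measure (EuclideanSpace ℝ (Fin n))).toSphere Set.univ)⁻¹ •
    (volume : Measure (EuclideanSpace ℝ (Fin n))).toSphere).map (dilateSphere n)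

/-- The projection `ℝⁿ → ℝᵏ` to the first `k` coordinates (missing coordinates are `0` when
`n < k`). -/
noncomputable def firstCoords (k : ℕ) {n : ℕ} (x : EuclideanSpace ℝ (Fin n)) :
    EuclideanSpace ℝ (Fin k) :=
  WithLp.toLp 2 fun i => if h : (i : ℕ) < n then x ⟨i, h⟩ else 0

/-- A function `f` on `ℝᵏ`, viewed as a function on `S^{n-1}(√n)` for every `n`. -/
noncomputable def onSphere {k : ℕ} (f : EuclideanSpace ℝ (Fin k) → ℝ) (n : ℕ)
    (x : RootSphere n) : ℝ :=
  f (firstCoords k (x : EuclideanSpace ℝ (Fin n)))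

/-!
The theorem has a geometric half and a nonstandard half.

Geometry. Let `n = k + j + 2` with `j > 0`. The law of the first `k` coordinates on `S^{n-1}(√n)`
has a density proportional to `(1 - ‖u‖² / n)^{j/2}` on `‖u‖ ≤ √n`
(`exists_map_firstCoords_sphereMeasure`). To see this, describe the sphere measure by cones, so that
the law is that of `√n y / ‖(y, z)‖` for `(y, z)` uniform in the unit ball of `ℝᵏ × ℝ^{j+2}`. The
substitution `y = ‖z‖ w` makes `w` independent of the radius, and `w = (1 - ‖x‖²)^{-1/2} x` brings
back the direction. These densities are at most `e^{(k+2)/2} e^{-‖u‖²/2}` and tend to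
`e^{-‖u‖²/2}`. The normalizing constants converge by dominated convergence, since the total masses
are `1`. So the laws are eventually dominated by a multiple of the Gaussian measure
(`exists_coordsLaw_le`), and `∫ f` converges for every Gaussian-integrable `f`
(`tendsto_integral_coordsLaw`). Applied to `f`, `|f| 1_{|f| ≥ m}` and indicators, this gives the
limits, the uniform integrability of `f` on the spheres, and the convergence of the laws of `f` on
all Borel sets. Only `f ∈ L¹` is needed.

Nonstandard half. An element `x` of `*A` is treated through the ultrafilter `typ x` of those `S ⊆ A`
with `x ∈ *S`. Then `*g(x) ≈ r` means that `g` tends to `r` along `typ x`, and `N > ℕ` gives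
`typ N ≤ atTop`. Saturation enters in one place: a countable cover of the space by internal sets has
a finite subcover, so the Loeb outer measure of the whole space is at least `1`, and the Loeb measure
extends `st ∘ ν_N` (`Event.loebMeasure_toSet`). Since the laws of `f` on the spheres converge on all
Borel sets, `st(*f)` has under the Loeb measure the law of `f` under the Gaussian measure
(`map_st_starFun`). Integrability of `st(*f)` and the value of its integral follow, while
`S`-integrability is uniform integrability read along `typ N`.
-/

/-! ### Elements of an extension as ultrafilters -/

namespace NonstandardExtension

variable (𝔘 : NonstandardExtension.{u}) {A B C : Type}

theorem starSet_mono {S T : Set A} (h : S ⊆ T) : 𝔘.starSet S ⊆ 𝔘.starSet T := by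
  have t := 𝔘.transfer (Γ := []) (.all A (.neg (.and
    (.rel (Δ := [A]) (fun e => e.1 ∈ S) (.zero, PUnit.unit))
    (.neg (.rel (Δ := [A]) (fun e => e.1 ∈ T) (.zero, PUnit.unit)))))) PUnit.unit
  simp only [SortFormula.Holds, SortVar.val, SortTuple.map, not_and, not_not] at t
  exact fun x => t.1 (fun a ha => h ha) x

theorem starSet_univ : 𝔘.starSet (Set.univ : Set A) = Set.univ := by
  have t := 𝔘.transfer (Γ := []) (.all A
    (.rel (Δ := [A]) (fun e => e.1 ∈ Set.univ) (.zero, PUnit.unit))) PUnit.unit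
  simp only [SortFormula.Holds, SortVar.val, SortTuple.map] at t
  exact Set.eq_univ_of_forall fun x => t.1 (fun a => trivial) x

theorem mem_starSet_inter {S T : Set A} {x : 𝔘.star A} (hS : x ∈ 𝔘.starSet S)
    (hT : x ∈ 𝔘.starSet T) : x ∈ 𝔘.starSet (S ∩ T) := by
  have t := 𝔘.transfer (Γ := []) (.all A (.neg (.and (.and
    (.rel (Δ := [A]) (fun e => e.1 ∈ S) (.zero, PUnit.unit))
    (.rel (Δ := [A]) (fun e => e.1 ∈ T) (.zero, PUnit.unit)))
    (.neg (.rel (Δ := [A]) (fun e => e.1 ∈ S ∩ T) (.zero, PUnit.unit)))))) PUnit.unit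
  simp only [SortFormula.Holds, SortVar.val, SortTuple.map, not_and, not_not] at t
  exact t.1 (fun a ha => ⟨ha.1, ha.2⟩) x ⟨hS, hT⟩

theorem mem_starSet_compl {S : Set A} {x : 𝔘.star A} :
    x ∈ 𝔘.starSet Sᶜ ↔ x ∉ 𝔘.starSet S := by
  have t₁ := 𝔘.transfer (Γ := []) (.all A (.neg (.and
    (.rel (Δ := [A]) (fun e => e.1 ∈ Sᶜ) (.zero, PUnit.unit))
    (.rel (Δ := [A]) (fun e => e.1 ∈ S) (.zero, PUnit.unit))))) PUnit.unit
  have t₂ := 𝔘.transfer (Γ := []) (.all A (.neg (.and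
    (.neg (.rel (Δ := [A]) (fun e => e.1 ∈ Sᶜ) (.zero, PUnit.unit)))
    (.neg (.rel (Δ := [A]) (fun e => e.1 ∈ S) (.zero, PUnit.unit)))))) PUnit.unit
  simp only [SortFormula.Holds, SortVar.val, SortTuple.map, not_and, not_not] at t₁ t₂
  exact ⟨fun h => t₁.1 (fun a ha => ha) x h,
    fun h => by_contra fun h' => h (t₂.1 (fun a ha => by simpa using ha) x h')⟩

/-- The sets `S ⊆ A` with `x ∈ *S` form an ultrafilter on `A`. Through it, statements about `x`
become statements about eventual behaviour and limits in `A`. -/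
def typ (x : 𝔘.star A) : Ultrafilter A :=
  Ultrafilter.ofComplNotMemIff
    { sets := {S | x ∈ 𝔘.starSet S}
      univ_sets := by simp [starSet_univ]
      sets_of_superset := fun h h' => 𝔘.starSet_mono h' h
      inter_sets := fun h h' => 𝔘.mem_starSet_inter h h' }
    fun S => by
      change x ∉ 𝔘.starSet Sᶜ ↔ x ∈ 𝔘.starSet S
      rw [mem_starSet_compl, not_not]

theorem eventually_typ {x : 𝔘.star A} {P : A → Prop} :
    (∀ᶠ a in (𝔘.typ x : Filter A), P a) ↔ x ∈ 𝔘.starSet {a | P a} := Iff.rfl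

theorem starRel₂_starMap_self (f : A → B) (x : 𝔘.star A) :
    𝔘.starRel₂ (fun a b => f a = b) x (𝔘.starMap f x) :=
  (𝔘.existsUnique_starRel₂_graph f x).choose_spec.1

theorem starRel₂_graph_iff {f : A → B} {x : 𝔘.star A} {y : 𝔘.star B} :
    𝔘.starRel₂ (fun a b => f a = b) x y ↔ 𝔘.starMap f x = y :=
  ⟨fun h => (𝔘.existsUnique_starRel₂_graph f x).unique (𝔘.starRel₂_starMap_self f x) h,
    fun h => h ▸ 𝔘.starRel₂_starMap_self f x⟩

theorem starMap_mem_starSet {f : A → B} {x : 𝔘.star A} {T : Set B} :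
    𝔘.starMap f x ∈ 𝔘.starSet T ↔ x ∈ 𝔘.starSet (f ⁻¹' T) := by
  have t := fun T : Set B => 𝔘.transfer (Γ := []) (.all A (.all B (.neg (.and (.and
    (.rel (Δ := [A, B]) (fun e => f e.1 = e.2.1) (.succ .zero, .zero, PUnit.unit))
    (.rel (Δ := [B]) (fun e => e.1 ∈ T) (.zero, PUnit.unit)))
    (.neg (.rel (Δ := [A]) (fun e => e.1 ∈ f ⁻¹' T) (.succ .zero, PUnit.unit))))))) PUnit.unit
  simp only [SortFormula.Holds, SortVar.val, SortTuple.map, not_and, not_not] at t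
  have key : ∀ T : Set B, 𝔘.starMap f x ∈ 𝔘.starSet T → x ∈ 𝔘.starSet (f ⁻¹' T) := fun T h =>
    (t T).1 (fun a b h => by simpa [h.1] using h.2) x _ ⟨𝔘.starRel₂_starMap_self f x, h⟩
  refine ⟨key T, fun h => by_contra fun h' => ?_⟩
  exact 𝔘.mem_starSet_compl.1 (key Tᶜ (𝔘.mem_starSet_compl.2 h')) h

theorem starMap_eq_iff {f g : A → B} {x : 𝔘.star A} :
    𝔘.starMap f x = 𝔘.starMap g x ↔ ∀ᶠ a in (𝔘.typ x : Filter A), f a = g a := by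
  have t₁ := 𝔘.transfer (Γ := []) (.all A (.all B (.neg (.and (.and
    (.rel (Δ := [A, B]) (fun e => f e.1 = e.2.1) (.succ .zero, .zero, PUnit.unit))
    (.rel (Δ := [A, B]) (fun e => g e.1 = e.2.1) (.succ .zero, .zero, PUnit.unit)))
    (.neg (.rel (Δ := [A]) (fun e => e.1 ∈ {a | f a = g a}) (.succ .zero, PUnit.unit)))))))
    PUnit.unit
  have t₂ := 𝔘.transfer (Γ := []) (.all A (.all B (.neg (.and (.and
    (.rel (Δ := [A, B]) (fun e => f e.1 = e.2.1) (.succ .zero, .zero, PUnit.unit))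
    (.rel (Δ := [A]) (fun e => e.1 ∈ {a | f a = g a}) (.succ .zero, PUnit.unit)))
    (.neg (.rel (Δ := [A, B]) (fun e => g e.1 = e.2.1) (.succ .zero, .zero, PUnit.unit)))))))
    PUnit.unit
  simp only [SortFormula.Holds, SortVar.val, SortTuple.map, not_and, not_not] at t₁ t₂
  refine ⟨fun h => t₁.1 (fun a b h => h.1.trans h.2.symm) x _
    ⟨𝔘.starRel₂_starMap_self f x, h ▸ 𝔘.starRel₂_starMap_self g x⟩, fun h => ?_⟩
  exact (𝔘.starRel₂_graph_iff.1 <| t₂.1 (fun a b h => (Eq.symm h.2).trans h.1) x _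
    ⟨𝔘.starRel₂_starMap_self f x, h⟩).symm

theorem starMap_comp (g : B → C) (f : A → B) (x : 𝔘.star A) :
    𝔘.starMap g (𝔘.starMap f x) = 𝔘.starMap (fun a => g (f a)) x := by
  have t := 𝔘.transfer (Γ := []) (.all A (.all B (.all C (.neg (.and (.and
    (.rel (Δ := [A, B]) (fun e => f e.1 = e.2.1) (.succ (.succ .zero), .succ .zero, PUnit.unit))
    (.rel (Δ := [B, C]) (fun e => g e.1 = e.2.1) (.succ .zero, .zero, PUnit.unit)))
    (.neg (.rel (Δ := [A, C]) (fun e => g (f e.1) = e.2.1)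
      (.succ (.succ .zero), .zero, PUnit.unit)))))))) PUnit.unit
  simp only [SortFormula.Holds, SortVar.val, SortTuple.map, not_and, not_not] at t
  have h : 𝔘.starRel₂ (fun a c => g (f a) = c) x (𝔘.starMap g (𝔘.starMap f x)) :=
    t.1 (fun a b c h => by rw [h.1, h.2]) x _ _
      ⟨𝔘.starRel₂_starMap_self f x, 𝔘.starRel₂_starMap_self g _⟩
  exact (𝔘.starRel₂_graph_iff.1 h).symm

theorem starMap_id (x : 𝔘.star A) : 𝔘.starMap (fun a => a) x = x := by
  have t := 𝔘.transfer (Γ := []) (.all A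
    (.rel (Δ := [A, A]) (fun e => e.1 = e.2.1) (.zero, .zero, PUnit.unit))) PUnit.unit
  simp only [SortFormula.Holds, SortVar.val, SortTuple.map] at t
  have h : 𝔘.starRel₂ (fun a b : A => a = b) x x := t.1 (fun a => trivial) x
  exact 𝔘.starRel₂_graph_iff.1 h

/-- Elements of `*A` and `*B` are the coordinates of an element of `*(A × B)`. -/
theorem exists_pair (x : 𝔘.star A) (y : 𝔘.star B) :
    ∃ z : 𝔘.star (A × B), 𝔘.starMap Prod.fst z = x ∧ 𝔘.starMap Prod.snd z = y := by
  have t := 𝔘.transfer (Γ := []) (.all A (.all B (.neg (.all (A × B) (.neg (.and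
    (.rel (Δ := [A × B, A]) (fun e => e.1.1 = e.2.1)
      (.zero, .succ (.succ .zero), PUnit.unit))
    (.rel (Δ := [A × B, B]) (fun e => e.1.2 = e.2.1)
      (.zero, .succ .zero, PUnit.unit)))))))) PUnit.unit
  simp only [SortFormula.Holds, SortVar.val, SortTuple.map] at t
  have h := t.1 (fun a b h => h (a, b) ⟨rfl, rfl⟩) x y
  push Not at h
  obtain ⟨z, h₁, h₂⟩ := h
  exact ⟨z, 𝔘.starRel₂_graph_iff.1 h₁, 𝔘.starRel₂_graph_iff.1 h₂⟩

/-- The extension of a relation holds between coordinates of `x` if and only if the relation holds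
eventually along `typ x`; with `exists_pair`, this replaces further uses of transfer. -/
theorem starRel₂_starMap {f : A → B} {g : A → C} {R : B → C → Prop} {x : 𝔘.star A} :
    𝔘.starRel₂ R (𝔘.starMap f x) (𝔘.starMap g x) ↔
      ∀ᶠ a in (𝔘.typ x : Filter A), R (f a) (g a) := by
  have t := fun R : B → C → Prop => 𝔘.transfer (Γ := []) (.all A (.all B (.all C (.neg (.and
    (.and (.rel (Δ := [A, B]) (fun e => f e.1 = e.2.1) (.succ (.succ .zero), .succ .zero, .unit))
      (.rel (Δ := [A, C]) (fun e => g e.1 = e.2.1) (.succ (.succ .zero), .zero, .unit)))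
    (.and (.rel (Δ := [B, C]) (fun e => R e.1 e.2.1) (.succ .zero, .zero, .unit))
      (.neg (.rel (Δ := [A]) (fun e => R (f e.1) (g e.1))
        (.succ (.succ .zero), .unit))))))))) .unit
  have t' := 𝔘.transfer (Γ := []) (.all A (.all B (.all C (.neg (.and
    (.and (.rel (Δ := [A, B]) (fun e => f e.1 = e.2.1) (.succ (.succ .zero), .succ .zero, .unit))
      (.rel (Δ := [A, C]) (fun e => g e.1 = e.2.1) (.succ (.succ .zero), .zero, .unit)))
    (.and (.rel (Δ := [A]) (fun e => R (f e.1) (g e.1)) (.succ (.succ .zero), .unit))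
      (.neg (.rel (Δ := [B, C]) (fun e => R e.1 e.2.1) (.succ .zero, .zero, .unit)))))))))
    .unit
  simp only [SortFormula.Holds, SortVar.val, SortTuple.map, not_and, not_not] at t t'
  have h₀ := And.intro (𝔘.starRel₂_starMap_self f x) (𝔘.starRel₂_starMap_self g x)
  exact ⟨fun h => (t R).1 (by rintro a b c ⟨rfl, rfl⟩ h; exact h) x _ _ h₀ h,
    fun h => t'.1 (by rintro a b c ⟨rfl, rfl⟩ h; exact h) x _ _ h₀ h⟩

theorem typ_starMap (f : A → B) (x : 𝔘.star A) : 𝔘.typ (𝔘.starMap f x) = (𝔘.typ x).map f :=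
  Ultrafilter.ext fun _ => 𝔘.starMap_mem_starSet

theorem IsHyperfinite.typ_le {N : 𝔘.star ℕ} (h : 𝔘.IsHyperfinite N) :
    (𝔘.typ N : Filter ℕ) ≤ atTop := by
  rw [← tendsto_id', Filter.tendsto_atTop]
  exact fun n => (𝔘.eventually_typ.2 (h n)).mono fun m hm => le_of_lt hm

theorem isNear_iff {y : 𝔘.star ℝ} {r : ℝ} : 𝔘.IsNear y r ↔ (𝔘.typ y : Filter ℝ) ≤ 𝓝 r := by
  rw [← tendsto_id', Metric.tendsto_nhds]
  rfl

theorem isNear_starMap {g : A → ℝ} {x : 𝔘.star A} {r : ℝ} :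
    𝔘.IsNear (𝔘.starMap g x) r ↔ Tendsto g (𝔘.typ x : Filter A) (𝓝 r) := by
  rw [isNear_iff, typ_starMap]
  rfl

theorem isFinite_starMap {g : A → ℝ} {x : 𝔘.star A} :
    𝔘.IsFinite (𝔘.starMap g x) ↔ ∃ r, ∀ᶠ a in (𝔘.typ x : Filter A), |g a| ≤ r :=
  exists_congr fun _ => 𝔘.starMap_mem_starSet

theorem IsNear.unique {y : 𝔘.star ℝ} {r s : ℝ} (hr : 𝔘.IsNear y r) (hs : 𝔘.IsNear y s) :
    r = s :=
  tendsto_nhds_unique (tendsto_id'.2 (𝔘.isNear_iff.1 hr)) (tendsto_id'.2 (𝔘.isNear_iff.1 hs))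

theorem IsNear.st_eq {y : 𝔘.star ℝ} {r : ℝ} (h : 𝔘.IsNear y r) : 𝔘.st y = r := by
  have h' : ∃ r, 𝔘.IsNear y r := ⟨r, h⟩
  rw [st, dif_pos h']
  exact IsNear.unique 𝔘 h'.choose_spec h

theorem IsNear.isFinite {y : 𝔘.star ℝ} {r : ℝ} (h : 𝔘.IsNear y r) : 𝔘.IsFinite y := by
  refine ⟨|r| + 1, 𝔘.starSet_mono (fun z hz => ?_) (h 1 one_pos)⟩
  have := abs_sub_abs_le_abs_sub z r
  simp only [Set.mem_ofPred_eq] at hz ⊢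
  linarith

/-- Every finite hyperreal has a standard part, by compactness of bounded intervals. -/
theorem IsFinite.isNear_st {y : 𝔘.star ℝ} (h : 𝔘.IsFinite y) : 𝔘.IsNear y (𝔘.st y) := by
  obtain ⟨r, hr⟩ := h
  have hr' : ∀ᶠ a in (𝔘.typ y : Filter ℝ), |a| ≤ r := hr
  obtain ⟨s, -, hs⟩ := (isCompact_Icc (a := -r) (b := r)).ultrafilter_le_nhds (𝔘.typ y)
    (le_principal_iff.2 <| hr'.mono fun a ha => abs_le.1 ha)
  have h := 𝔘.isNear_iff.2 hs
  rwa [IsNear.st_eq 𝔘 h]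

theorem st_of_not_isFinite {y : 𝔘.star ℝ} (h : ¬ 𝔘.IsFinite y) : 𝔘.st y = 0 :=
  dif_neg fun ⟨_, hr⟩ => h (IsNear.isFinite 𝔘 hr)

end NonstandardExtension

/-! ### The internal algebra -/

namespace NonstandardExtension

section IndexedSets

variable {Ω : ℕ → Type} [∀ n, MeasurableSpace (Ω n)]

/-- Membership of a point of the disjoint union of the `Ω_n` in a measurable subset of some
`Ω_n`; the internal sets are defined by the extension of this relation. -/
def SigmaMem (a : Σ n, Ω n) (S : Σ n, {S : Set (Ω n) // MeasurableSet S}) : Prop :=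
  ∃ (n : ℕ) (ω : Ω n) (T : {T : Set (Ω n) // MeasurableSet T}),
    a = ⟨n, ω⟩ ∧ S = ⟨n, T⟩ ∧ ω ∈ T.1

theorem sigmaMem_mk {n : ℕ} {ω : Ω n} {T : {T : Set (Ω n) // MeasurableSet T}} :
    SigmaMem (⟨n, ω⟩ : Σ n, Ω n) ⟨n, T⟩ ↔ ω ∈ T.1 := by
  constructor
  · rintro ⟨m, ω', T', h, h', hm⟩
    cases h
    cases h'
    exact hm
  · exact fun h => ⟨n, ω, T, rfl, rfl, h⟩

theorem SigmaMem.fst_eq {a : Σ n, Ω n} {S : Σ n, {S : Set (Ω n) // MeasurableSet S}}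
    (h : SigmaMem a S) : a.1 = S.1 := by
  obtain ⟨n, ω, T, rfl, rfl, -⟩ := h
  rfl

/-- The part in `Ω_n` of a measurable subset of some `Ω_m`: it is empty unless `m = n`. -/
def slice (S : Σ n, {S : Set (Ω n) // MeasurableSet S}) (n : ℕ) : Set (Ω n) :=
  {ω | SigmaMem ⟨n, ω⟩ S}

theorem slice_mk (n : ℕ) (T : {T : Set (Ω n) // MeasurableSet T}) : slice ⟨n, T⟩ n = T.1 :=
  Set.ext fun _ => sigmaMem_mk

theorem measurableSet_slice (S : Σ n, {S : Set (Ω n) // MeasurableSet S}) (n : ℕ) :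
    MeasurableSet (slice S n) := by
  obtain ⟨m, T⟩ := S
  by_cases h : m = n
  · subst h
    rw [slice_mk]
    exact T.2
  · convert MeasurableSet.empty
    exact Set.eq_empty_of_forall_notMem fun ω hω => h (SigmaMem.fst_eq hω).symm

/-- The intersection of two sets of a pair, in the space that contains the first one. -/
def pairInter (p : (Σ n, {S : Set (Ω n) // MeasurableSet S}) ×
    (Σ n, {S : Set (Ω n) // MeasurableSet S})) : Σ n, {S : Set (Ω n) // MeasurableSet S} :=
  ⟨p.1.1, p.1.2.1 ∩ slice p.2 p.1.1, p.1.2.2.inter (measurableSet_slice _ _)⟩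

/-- The difference of two sets of a pair, in the space that contains the first one. -/
def pairDiff (p : (Σ n, {S : Set (Ω n) // MeasurableSet S}) ×
    (Σ n, {S : Set (Ω n) // MeasurableSet S})) : Σ n, {S : Set (Ω n) // MeasurableSet S} :=
  ⟨p.1.1, p.1.2.1 \ slice p.2 p.1.1, p.1.2.2.diff (measurableSet_slice _ _)⟩

/-- The union of two sets of a pair, in the space that contains the first one. -/
def pairUnion (p : (Σ n, {S : Set (Ω n) // MeasurableSet S}) ×
    (Σ n, {S : Set (Ω n) // MeasurableSet S})) : Σ n, {S : Set (Ω n) // MeasurableSet S} :=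
  ⟨p.1.1, p.1.2.1 ∪ slice p.2 p.1.1, p.1.2.2.union (measurableSet_slice _ _)⟩

variable {a : Σ n, Ω n} {p : (Σ n, {S : Set (Ω n) // MeasurableSet S}) ×
    (Σ n, {S : Set (Ω n) // MeasurableSet S})}

theorem sigmaMem_pairInter : SigmaMem a (pairInter p) ↔ SigmaMem a p.1 ∧ SigmaMem a p.2 := by
  obtain ⟨n, ω⟩ := a
  obtain ⟨⟨m, S⟩, T⟩ := p
  by_cases h : n = m
  · subst h
    simp only [pairInter, sigmaMem_mk]
    rfl
  · exact ⟨fun h' => absurd h'.fst_eq h, fun h' => absurd h'.1.fst_eq h⟩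

theorem sigmaMem_pairDiff : SigmaMem a (pairDiff p) ↔ SigmaMem a p.1 ∧ ¬ SigmaMem a p.2 := by
  obtain ⟨n, ω⟩ := a
  obtain ⟨⟨m, S⟩, T⟩ := p
  by_cases h : n = m
  · subst h
    simp only [pairDiff, sigmaMem_mk]
    rfl
  · exact ⟨fun h' => absurd h'.fst_eq h, fun h' => absurd h'.1.fst_eq h⟩

theorem sigmaMem_pairUnion (hp : p.1.1 = p.2.1) :
    SigmaMem a (pairUnion p) ↔ SigmaMem a p.1 ∨ SigmaMem a p.2 := by
  obtain ⟨n, ω⟩ := a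
  obtain ⟨⟨m, S⟩, T⟩ := p
  by_cases h : n = m
  · subst h
    simp only [pairUnion, sigmaMem_mk]
    rfl
  · exact ⟨fun h' => absurd h'.fst_eq h, fun h' => h'.elim (fun h' => absurd h'.fst_eq h)
      fun h' => absurd (h'.fst_eq.trans hp.symm) h⟩

end IndexedSets

variable (𝔘 : NonstandardExtension.{u})
variable {Ω : ℕ → Type} [∀ n, MeasurableSpace (Ω n)] {ν : ∀ n, Measure (Ω n)} {N : 𝔘.star ℕ}

theorem Space.map_typ (x : 𝔘.Space ν N) : (𝔘.typ x.1).map Sigma.fst = 𝔘.typ N := by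
  rw [← typ_starMap, x.2]

theorem Event.map_typ (B : 𝔘.Event ν N) : (𝔘.typ B.1).map Sigma.fst = 𝔘.typ N := by
  rw [← typ_starMap, B.2]

theorem Space.eventually {P : ℕ → Prop} (h : ∀ᶠ n in (𝔘.typ N : Filter ℕ), P n)
    (x : 𝔘.Space ν N) : ∀ᶠ a in (𝔘.typ x.1).toFilter, P a.1 := by
  rw [← Space.map_typ 𝔘 x] at h
  exact h

theorem Event.eventually {P : ℕ → Prop} (h : ∀ᶠ n in (𝔘.typ N : Filter ℕ), P n)
    (B : 𝔘.Event ν N) : ∀ᶠ S in (𝔘.typ B.1).toFilter, P S.1 := by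
  rw [← Event.map_typ 𝔘 B] at h
  exact h

theorem Event.mem_toSet_iff {K : Type} {w : 𝔘.star K} {g : K → Σ n, Ω n}
    {h : K → Σ n, {S : Set (Ω n) // MeasurableSet S}} {x : 𝔘.Space ν N} {B : 𝔘.Event ν N}
    (hx : 𝔘.starMap g w = x.1) (hB : 𝔘.starMap h w = B.1) :
    x ∈ Event.toSet 𝔘 B ↔ ∀ᶠ c in (𝔘.typ w : Filter K), SigmaMem (g c) (h c) := by
  rw [← starRel₂_starMap, hx, hB]
  rfl

/-- Along the ultrafilter of `w`, the measure of `h c` converges to the standard part of the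
internal measure of the event `*h(w)`. -/
theorem Event.tendsto_measure (hν : ∀ᶠ n in (𝔘.typ N : Filter ℕ), IsProbabilityMeasure (ν n))
    {K : Type} {w : 𝔘.star K} {h : K → Σ n, {S : Set (Ω n) // MeasurableSet S}}
    {B : 𝔘.Event ν N} (hB : 𝔘.starMap h w = B.1) :
    Tendsto (fun c => (ν (h c).1).real (h c).2.1) (𝔘.typ w)
      (𝓝 (𝔘.st (𝔘.internalMeasure B))) := by
  have hm : 𝔘.internalMeasure B = 𝔘.starMap (fun c => (ν (h c).1).real (h c).2.1) w := by
    rw [internalMeasure, ← hB, starMap_comp]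
  have hf : 𝔘.IsFinite (𝔘.internalMeasure B) :=
    𝔘.isFinite_starMap.2 ⟨1, (Event.eventually 𝔘 hν B).mono fun S hS => by
      rw [abs_of_nonneg measureReal_nonneg]
      exact measureReal_le_one⟩
  have := IsFinite.isNear_st 𝔘 hf
  rw [hm, isNear_starMap] at this
  rwa [hm]

theorem Event.exists_pair (B C : 𝔘.Event ν N) :
    ∃ z, 𝔘.starMap Prod.fst z = B.1 ∧ 𝔘.starMap Prod.snd z = C.1 ∧
      ∀ᶠ p in (𝔘.typ z).toFilter, p.1.1 = p.2.1 := by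
  obtain ⟨z, h₁, h₂⟩ := 𝔘.exists_pair B.1 C.1
  refine ⟨z, h₁, h₂, 𝔘.starMap_eq_iff.1 ?_⟩
  rw [← 𝔘.starMap_comp Sigma.fst Prod.fst, ← 𝔘.starMap_comp Sigma.fst Prod.snd, h₁, h₂, B.2, C.2]

/-- The event `*op(B, C)` of an operation on pairs of sets that stays in the space of the first
set. -/
noncomputable def Event.ofPair {B : 𝔘.Event ν N}
    (op : (Σ n, {S : Set (Ω n) // MeasurableSet S}) × (Σ n, {S : Set (Ω n) // MeasurableSet S}) →
      Σ n, {S : Set (Ω n) // MeasurableSet S}) (hop : ∀ p, (op p).1 = p.1.1)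
    {z : 𝔘.star ((Σ n, {S : Set (Ω n) // MeasurableSet S}) ×
      (Σ n, {S : Set (Ω n) // MeasurableSet S}))} (hz : 𝔘.starMap Prod.fst z = B.1) : 𝔘.Event ν N :=
  ⟨𝔘.starMap op z, by rw [starMap_comp, ← B.2, ← hz, starMap_comp]; simp only [hop]⟩

theorem Event.exists_inter_diff
    (hν : ∀ᶠ n in (𝔘.typ N : Filter ℕ), IsProbabilityMeasure (ν n)) (B C : 𝔘.Event ν N) :
    ∃ D D' : 𝔘.Event ν N, Event.toSet 𝔘 D = Event.toSet 𝔘 B ∩ Event.toSet 𝔘 C ∧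
      Event.toSet 𝔘 D' = Event.toSet 𝔘 B \ Event.toSet 𝔘 C ∧
      𝔘.st (𝔘.internalMeasure D) + 𝔘.st (𝔘.internalMeasure D') =
        𝔘.st (𝔘.internalMeasure B) := by
  obtain ⟨z, hB, hC, hz⟩ := Event.exists_pair 𝔘 B C
  let D := Event.ofPair 𝔘 pairInter (fun _ => rfl) hB
  let D' := Event.ofPair 𝔘 pairDiff (fun _ => rfl) hB
  have hD : 𝔘.starMap pairInter z = D.1 := rfl
  have hD' : 𝔘.starMap pairDiff z = D'.1 := rfl
  refine ⟨D, D', ?_, ?_, ?_⟩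
  · ext x
    obtain ⟨w, hw, hw'⟩ := 𝔘.exists_pair x.1 z
    rw [← hw', starMap_comp] at hB hC hD
    rw [Set.mem_inter_iff, Event.mem_toSet_iff 𝔘 hw hD, Event.mem_toSet_iff 𝔘 hw hB,
      Event.mem_toSet_iff 𝔘 hw hC, ← eventually_and]
    simp only [sigmaMem_pairInter]
  · ext x
    obtain ⟨w, hw, hw'⟩ := 𝔘.exists_pair x.1 z
    rw [← hw', starMap_comp] at hB hC hD'
    rw [Set.mem_sdiff, Event.mem_toSet_iff 𝔘 hw hD', Event.mem_toSet_iff 𝔘 hw hB,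
      Event.mem_toSet_iff 𝔘 hw hC, ← Ultrafilter.eventually_not, ← eventually_and]
    simp only [sigmaMem_pairDiff]
  · refine tendsto_nhds_unique (((Event.tendsto_measure 𝔘 hν hD).add
      (Event.tendsto_measure 𝔘 hν hD')).congr' ?_) (Event.tendsto_measure 𝔘 hν hB)
    have hν' := Event.eventually 𝔘 hν B
    rw [← hB, typ_starMap] at hν'
    filter_upwards [show ∀ᶠ p in (𝔘.typ z).toFilter, IsProbabilityMeasure (ν p.1.1) from hν']
      with p hp
    exact measureReal_inter_add_sdiff (μ := ν p.1.1) (s := p.1.2.1) (measurableSet_slice p.2 p.1.1)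

theorem Event.exists_union
    (hν : ∀ᶠ n in (𝔘.typ N : Filter ℕ), IsProbabilityMeasure (ν n)) (B C : 𝔘.Event ν N) :
    ∃ D : 𝔘.Event ν N, Event.toSet 𝔘 D = Event.toSet 𝔘 B ∪ Event.toSet 𝔘 C ∧
      𝔘.st (𝔘.internalMeasure D) ≤
        𝔘.st (𝔘.internalMeasure B) + 𝔘.st (𝔘.internalMeasure C) := by
  obtain ⟨z, hB, hC, hz⟩ := Event.exists_pair 𝔘 B C
  let D := Event.ofPair 𝔘 pairUnion (fun _ => rfl) hB
  have hD : 𝔘.starMap pairUnion z = D.1 := rfl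
  refine ⟨D, ?_, ?_⟩
  · ext x
    obtain ⟨w, hw, hw'⟩ := 𝔘.exists_pair x.1 z
    rw [← hw', typ_starMap] at hz
    rw [← hw', starMap_comp] at hB hC hD
    rw [Set.mem_union, Event.mem_toSet_iff 𝔘 hw hD, Event.mem_toSet_iff 𝔘 hw hB,
      Event.mem_toSet_iff 𝔘 hw hC, ← Ultrafilter.eventually_or]
    exact eventually_congr (Eventually.mono (f := (𝔘.typ w).toFilter)
      (show ∀ᶠ c in (𝔘.typ w).toFilter, c.2.1.1 = c.2.2.1 from hz)
      fun c hc => sigmaMem_pairUnion hc)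
  · refine le_of_tendsto_of_tendsto (Event.tendsto_measure 𝔘 hν hD)
      ((Event.tendsto_measure 𝔘 hν hB).add (Event.tendsto_measure 𝔘 hν hC)) ?_
    filter_upwards [hz] with ⟨⟨n, S⟩, ⟨m, T⟩⟩ hp
    obtain rfl : n = m := hp
    refine (measureReal_union_le _ _).trans_eq ?_
    rw [slice_mk]
    rfl

/-- The event given by a sequence of measurable sets `E_n ⊆ Ω_n`. -/
noncomputable def Event.ofSeq (ν : ∀ n, Measure (Ω n)) (N : 𝔘.star ℕ) (E : ∀ n, Set (Ω n))
    (hE : ∀ n, MeasurableSet (E n)) : 𝔘.Event ν N :=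
  ⟨𝔘.starMap (fun n => ⟨n, E n, hE n⟩) N, by rw [starMap_comp]; exact 𝔘.starMap_id N⟩

theorem Event.mem_ofSeq {E : ∀ n, Set (Ω n)} {hE : ∀ n, MeasurableSet (E n)} {x : 𝔘.Space ν N} :
    x ∈ Event.toSet 𝔘 (Event.ofSeq 𝔘 ν N E hE) ↔
      ∀ᶠ a in (𝔘.typ x.1).toFilter, a.2 ∈ E a.1 := by
  rw [Event.mem_toSet_iff 𝔘 (𝔘.starMap_id x.1) (h := fun a => ⟨a.1, E a.1, hE a.1⟩)]
  · exact eventually_congr (Eventually.of_forall fun _ => sigmaMem_mk)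
  · rw [← 𝔘.starMap_comp (fun n => (⟨n, E n, hE n⟩ : Σ n, {S : Set (Ω n) // MeasurableSet S}))
      Sigma.fst x.1, x.2]
    rfl

theorem Event.tendsto_ofSeq (hν : ∀ᶠ n in (𝔘.typ N : Filter ℕ), IsProbabilityMeasure (ν n))
    {E : ∀ n, Set (Ω n)} {hE : ∀ n, MeasurableSet (E n)} :
    Tendsto (fun n => (ν n).real (E n)) (𝔘.typ N)
      (𝓝 (𝔘.st (𝔘.internalMeasure (Event.ofSeq 𝔘 ν N E hE)))) :=
  Event.tendsto_measure 𝔘 hν (w := N) (h := fun n => ⟨n, E n, hE n⟩) rfl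

/-- The internal measure is monotone. If `B ⊄ C` held on a set of the ultrafilter, a choice of
points witnessing it would give a point of `B \ C`. -/
theorem Event.st_internalMeasure_mono [Nonempty (Σ n, Ω n)]
    (hν : ∀ᶠ n in (𝔘.typ N : Filter ℕ), IsProbabilityMeasure (ν n)) {B C : 𝔘.Event ν N}
    (h : Event.toSet 𝔘 B ⊆ Event.toSet 𝔘 C) :
    𝔘.st (𝔘.internalMeasure B) ≤ 𝔘.st (𝔘.internalMeasure C) := by
  obtain ⟨z, hB, hC, hz⟩ := Event.exists_pair 𝔘 B C
  -- `W` picks a point of the first set outside the second one whenever there is one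
  have key : ∀ᶠ p in (𝔘.typ z).toFilter, ∀ a, SigmaMem a p.1 → SigmaMem a p.2 := by
    by_contra hcon
    rw [← Ultrafilter.eventually_not] at hcon
    have hW : ∀ p : (Σ n, {S : Set (Ω n) // MeasurableSet S}) ×
        (Σ n, {S : Set (Ω n) // MeasurableSet S}), ∃ a,
        (¬ ∀ a, SigmaMem a p.1 → SigmaMem a p.2) → SigmaMem a p.1 ∧ ¬ SigmaMem a p.2 := by
      intro p
      by_cases hp : ∃ a, SigmaMem a p.1 ∧ ¬ SigmaMem a p.2
      · exact ⟨hp.choose, fun _ => hp.choose_spec⟩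
      · exact ⟨Classical.arbitrary _, fun h' => by push Not at h'; exact absurd h' hp⟩
    choose W hW using hW
    let x : 𝔘.Space ν N := ⟨𝔘.starMap W z, by
      rw [starMap_comp, ← B.2, ← hB, starMap_comp, starMap_eq_iff]
      exact hcon.mono fun p hp => (hW p hp).1.fst_eq⟩
    have hxB : x ∈ Event.toSet 𝔘 B :=
      (Event.mem_toSet_iff 𝔘 (x := x) rfl hB).2 (hcon.mono fun p hp => (hW p hp).1)
    have hxC := (Event.mem_toSet_iff 𝔘 (x := x) rfl hC).1 (h hxB)
    exact (Ultrafilter.eventually_not.1 (hcon.mono fun p hp => (hW p hp).2)) hxC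
  refine le_of_tendsto_of_tendsto (Event.tendsto_measure 𝔘 hν hB)
    (Event.tendsto_measure 𝔘 hν hC) ?_
  have hν' := Event.eventually 𝔘 hν B
  rw [← hB, typ_starMap] at hν'
  filter_upwards [key, hz, show ∀ᶠ p in (𝔘.typ z).toFilter, IsProbabilityMeasure (ν p.1.1)
    from hν'] with ⟨⟨n, S⟩, ⟨m, T⟩⟩ hp hp' _
  obtain rfl : n = m := hp'
  exact measureReal_mono fun ω hω => sigmaMem_mk.1 (hp ⟨n, ω⟩ (sigmaMem_mk.2 hω))

end NonstandardExtension

/-! ### Loeb measure -/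

namespace NonstandardExtension

variable (𝔘 : NonstandardExtension.{u})
variable {Ω : ℕ → Type} [∀ n, MeasurableSpace (Ω n)] {ν : ∀ n, Measure (Ω n)} {N : 𝔘.star ℕ}

theorem Event.st_internalMeasure_nonneg
    (hν : ∀ᶠ n in (𝔘.typ N : Filter ℕ), IsProbabilityMeasure (ν n)) (B : 𝔘.Event ν N) :
    0 ≤ 𝔘.st (𝔘.internalMeasure B) :=
  ge_of_tendsto (Event.tendsto_measure 𝔘 hν (h := fun S => S) (𝔘.starMap_id B.1))
    (Eventually.of_forall fun _ => measureReal_nonneg)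

theorem Event.st_internalMeasure_ofSeq
    (hν : ∀ᶠ n in (𝔘.typ N : Filter ℕ), IsProbabilityMeasure (ν n))
    {E : ∀ n, Set (Ω n)} {hE : ∀ n, MeasurableSet (E n)} {r : ℝ}
    (h : Tendsto (fun n => (ν n).real (E n)) (𝔘.typ N) (𝓝 r)) :
    𝔘.st (𝔘.internalMeasure (Event.ofSeq 𝔘 ν N E hE)) = r :=
  tendsto_nhds_unique (Event.tendsto_ofSeq 𝔘 hν) h

theorem Event.toSet_ofSeq_univ :
    Event.toSet 𝔘 (Event.ofSeq 𝔘 ν N (fun _ => Set.univ) fun _ => .univ) = Set.univ :=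
  Set.eq_univ_of_forall fun _ => (Event.mem_ofSeq 𝔘).2 (Eventually.of_forall fun _ => trivial)

theorem Event.toSet_ofSeq_empty :
    Event.toSet 𝔘 (Event.ofSeq 𝔘 ν N (fun _ => ∅) fun _ => .empty) = ∅ :=
  Set.eq_empty_of_forall_notMem fun x hx => by
    have h := (Event.mem_ofSeq 𝔘).1 hx
    simp only [Set.mem_empty_iff_false] at h
    exact ((𝔘.typ x.1).neBot.1 (eventually_false_iff_eq_bot.1 h)).elim

theorem Event.st_internalMeasure_univ
    (hν : ∀ᶠ n in (𝔘.typ N : Filter ℕ), IsProbabilityMeasure (ν n)) :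
    𝔘.st (𝔘.internalMeasure (Event.ofSeq 𝔘 ν N (fun _ => Set.univ) fun _ => .univ)) = 1 := by
  refine Event.st_internalMeasure_ofSeq 𝔘 hν (tendsto_const_nhds.congr' ?_)
  filter_upwards [hν] with n _
  exact probReal_univ.symm

theorem Event.st_internalMeasure_empty
    (hν : ∀ᶠ n in (𝔘.typ N : Filter ℕ), IsProbabilityMeasure (ν n)) :
    𝔘.st (𝔘.internalMeasure (Event.ofSeq 𝔘 ν N (fun _ => ∅) fun _ => .empty)) = 0 :=
  Event.st_internalMeasure_ofSeq 𝔘 hν (by simp)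

/-- Internal sets are Carathéodory measurable, since `st ∘ ν_N` is finitely additive. -/
theorem Event.measurableSet_toSet
    (hν : ∀ᶠ n in (𝔘.typ N : Filter ℕ), IsProbabilityMeasure (ν n)) (B : 𝔘.Event ν N) :
    MeasurableSet (Event.toSet 𝔘 B) := by
  refine OuterMeasure.boundedBy_caratheodory fun t => le_iInf₂ fun C hC => ?_
  subst hC
  obtain ⟨D, D', hD, hD', h⟩ := Event.exists_inter_diff 𝔘 hν C B
  rw [← h, ENNReal.ofReal_add (Event.st_internalMeasure_nonneg 𝔘 hν _)
    (Event.st_internalMeasure_nonneg 𝔘 hν _)]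
  exact add_le_add (iInf₂_le D hD) (iInf₂_le D' hD')

theorem loebMeasure_apply {s : Set (𝔘.Space ν N)} (hs : MeasurableSet s) :
    𝔘.loebMeasure ν N s = 𝔘.loebOuter ν N s :=
  toMeasure_apply _ _ hs

theorem Event.loebMeasure_toSet_le
    (hν : ∀ᶠ n in (𝔘.typ N : Filter ℕ), IsProbabilityMeasure (ν n)) (B : 𝔘.Event ν N) :
    𝔘.loebMeasure ν N (Event.toSet 𝔘 B) ≤ ENNReal.ofReal (𝔘.st (𝔘.internalMeasure B)) := by
  rw [loebMeasure_apply 𝔘 (Event.measurableSet_toSet 𝔘 hν B)]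
  exact (OuterMeasure.boundedBy_le _).trans (iInf_le_of_le B (iInf_le_of_le rfl le_rfl))

theorem Event.exists_iUnion_lt
    (hν : ∀ᶠ n in (𝔘.typ N : Filter ℕ), IsProbabilityMeasure (ν n)) (B : ℕ → 𝔘.Event ν N)
    (n : ℕ) : ∃ D : 𝔘.Event ν N, Event.toSet 𝔘 D = ⋃ i < n, Event.toSet 𝔘 (B i) ∧
      𝔘.st (𝔘.internalMeasure D) ≤ ∑ i ∈ Finset.range n, 𝔘.st (𝔘.internalMeasure (B i)) := by
  induction n with
  | zero =>
    exact ⟨_, by simp [Event.toSet_ofSeq_empty 𝔘], (Event.st_internalMeasure_empty 𝔘 hν).le⟩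
  | succ n ih =>
    obtain ⟨D, hD, hD'⟩ := ih
    obtain ⟨D₁, h, h'⟩ := Event.exists_union 𝔘 hν D (B n)
    refine ⟨D₁, ?_, ?_⟩
    · rw [h, hD, Set.biUnion_lt_succ]
    · rw [Finset.sum_range_succ]
      linarith

/-- The complement of an internal set is an internal subset of the extension of the disjoint
union of the `Ω_n`, where saturation applies. -/
theorem Event.isInternal_compl (B : 𝔘.Event ν N) :
    𝔘.IsInternal (Subtype.val '' (Event.toSet 𝔘 B)ᶜ) := by
  refine ⟨𝔘.starMap (fun S => {a | a.1 = S.1 ∧ ¬ SigmaMem a S}) B.1, ?_⟩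
  ext x
  obtain ⟨w, hw, hw'⟩ := 𝔘.exists_pair x B.1
  have h₁ : x ∈ 𝔘.internalSet (𝔘.starMap (fun S => {a | a.1 = S.1 ∧ ¬ SigmaMem a S}) B.1) ↔
      (∀ᶠ c in (𝔘.typ w).toFilter, c.1.1 = c.2.1) ∧
        ¬ ∀ᶠ c in (𝔘.typ w).toFilter, SigmaMem c.1 c.2 := by
    rw [← Ultrafilter.eventually_not, ← eventually_and, internalSet, Set.mem_ofPred_eq, ← hw, ← hw',
      starMap_comp, starRel₂_starMap]
    rfl
  have h₂ : 𝔘.starMap Sigma.fst x = N ↔ ∀ᶠ c in (𝔘.typ w).toFilter, c.1.1 = c.2.1 := by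
    rw [← starMap_eq_iff, ← B.2, ← hw, ← hw', starMap_comp, starMap_comp]
  rw [h₁, ← h₂]
  constructor
  · rintro ⟨hx, h⟩
    exact ⟨⟨x, hx⟩, fun h' => h ((Event.mem_toSet_iff 𝔘 (x := ⟨x, hx⟩) hw hw').1 h'), rfl⟩
  · rintro ⟨x, h, rfl⟩
    exact ⟨x.2, fun h' => h ((Event.mem_toSet_iff 𝔘 hw hw').2 h')⟩

/-- Countable saturation: a countable cover of the space by internal sets has a finite
subcover. -/
theorem Event.exists_finite_subcover (h𝔘 : 𝔘.IsSaturated (Cardinal.aleph 1))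
    (hν : ∀ᶠ n in (𝔘.typ N : Filter ℕ), IsProbabilityMeasure (ν n)) (B : ℕ → 𝔘.Event ν N)
    (hB : ⋃ i, Event.toSet 𝔘 (B i) = Set.univ) :
    ∃ n, ⋃ i < n, Event.toSet 𝔘 (B i) = Set.univ := by
  by_contra! hcon
  choose D hD _ using Event.exists_iUnion_lt 𝔘 hν B
  let c : ℕ → Set (𝔘.star (Σ n, Ω n)) := fun n => Subtype.val '' (Event.toSet 𝔘 (D n))ᶜ
  have hc : Antitone c := fun m n hmn => Set.image_mono <| Set.compl_subset_compl.2 <| by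
    rw [hD, hD]
    exact Set.biUnion_subset_biUnion_left fun i (hi : i < m) => hi.trans_le hmn
  obtain ⟨x, hx⟩ := h𝔘 _ (Set.range c) (by rintro _ ⟨n, rfl⟩; exact Event.isInternal_compl 𝔘 _)
    ((Set.countable_range c).le_aleph0.trans_lt Cardinal.aleph0_lt_aleph_one) (by
      intro F hF hfin
      obtain ⟨M, hM⟩ := ((eventually_all_finite hfin).2 fun S hS => by
        obtain ⟨n, rfl⟩ := hF hS
        filter_upwards [eventually_ge_atTop n] with m hm using hc hm :
          ∀ᶠ m in atTop, ∀ S ∈ F, c m ⊆ S).exists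
      obtain ⟨y, hy⟩ := (Set.ne_univ_iff_exists_notMem _).1 (hcon M)
      exact ⟨y.1, fun S hS => hM S hS ⟨y, fun h => hy (hD M ▸ h), rfl⟩⟩)
  have hx' : ∀ n, x ∈ c n := fun n => hx _ ⟨n, rfl⟩
  obtain ⟨y, -, rfl⟩ := hx' 0
  have hy : y ∈ ⋃ i, Event.toSet 𝔘 (B i) := hB ▸ trivial
  obtain ⟨i, hi⟩ := Set.mem_iUnion.1 hy
  obtain ⟨y', hy', h⟩ := hx' (i + 1)
  obtain rfl : y' = y := Subtype.val_injective h
  refine hy' ?_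
  rw [hD]
  exact Set.mem_biUnion (Nat.lt_succ_self i) hi

/-- In a countable cover with finite cost all sets are internal, and finitely many of them cover. -/
theorem one_le_loebOuter_univ [Nonempty (Σ n, Ω n)] (h𝔘 : 𝔘.IsSaturated (Cardinal.aleph 1))
    (hν : ∀ᶠ n in (𝔘.typ N : Filter ℕ), IsProbabilityMeasure (ν n)) :
    1 ≤ 𝔘.loebOuter ν N Set.univ := by
  rw [loebOuter, OuterMeasure.boundedBy_apply]
  refine le_iInf₂ fun t ht => ?_
  by_cases hint : ∀ i, ∃ B : 𝔘.Event ν N, Event.toSet 𝔘 B = t i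
  · choose B hB using hint
    obtain ⟨n, hn⟩ := Event.exists_finite_subcover 𝔘 h𝔘 hν B
      (by simpa only [hB] using Set.univ_subset_iff.1 ht)
    obtain ⟨D, hD, hD'⟩ := Event.exists_iUnion_lt 𝔘 hν B n
    have h1 : 1 ≤ 𝔘.st (𝔘.internalMeasure D) := by
      rw [← Event.st_internalMeasure_univ 𝔘 hν]
      exact Event.st_internalMeasure_mono 𝔘 hν (by rw [hD, hn]; exact Set.subset_univ _)
    have hle : ∀ i, ENNReal.ofReal (𝔘.st (𝔘.internalMeasure (B i))) ≤
        ⨆ _ : (t i).Nonempty, ⨅ (C : 𝔘.Event ν N) (_ : Event.toSet 𝔘 C = t i),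
          ENNReal.ofReal (𝔘.st (𝔘.internalMeasure C)) := by
      intro i
      rcases (t i).eq_empty_or_nonempty with h | h
      · have : 𝔘.st (𝔘.internalMeasure (B i)) ≤ 0 := by
          rw [← Event.st_internalMeasure_empty 𝔘 hν]
          refine Event.st_internalMeasure_mono 𝔘 hν ?_
          rw [hB, h]
          exact Set.empty_subset _
        rw [ENNReal.ofReal_of_nonpos this]
        exact zero_le
      · refine le_iSup_of_le h (le_iInf₂ fun C hC => ENNReal.ofReal_le_ofReal ?_)
        exact Event.st_internalMeasure_mono 𝔘 hν (hB i ▸ hC.ge)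
    calc (1 : ENNReal) = ENNReal.ofReal 1 := ENNReal.ofReal_one.symm
      _ ≤ ENNReal.ofReal (∑ i ∈ Finset.range n, 𝔘.st (𝔘.internalMeasure (B i))) :=
        ENNReal.ofReal_le_ofReal (h1.trans hD')
      _ = ∑ i ∈ Finset.range n, ENNReal.ofReal (𝔘.st (𝔘.internalMeasure (B i))) :=
        ENNReal.ofReal_sum_of_nonneg fun i _ => Event.st_internalMeasure_nonneg 𝔘 hν _
      _ ≤ _ := (Finset.sum_le_sum fun i _ => hle i).trans (ENNReal.sum_le_tsum _)
  · push Not at hint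
    obtain ⟨i, hi⟩ := hint
    have hne : (t i).Nonempty := Set.nonempty_iff_ne_empty.2 fun h =>
      hi _ ((Event.toSet_ofSeq_empty 𝔘).trans h.symm)
    refine le_trans ?_ (ENNReal.le_tsum i)
    refine le_iSup_of_le hne (le_iInf₂ fun C hC => absurd hC (hi C))

theorem isProbabilityMeasure_loebMeasure [Nonempty (Σ n, Ω n)]
    (h𝔘 : 𝔘.IsSaturated (Cardinal.aleph 1))
    (hν : ∀ᶠ n in (𝔘.typ N : Filter ℕ), IsProbabilityMeasure (ν n)) :
    IsProbabilityMeasure (𝔘.loebMeasure ν N) := by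
  refine ⟨le_antisymm ?_ ?_⟩
  · have := Event.loebMeasure_toSet_le 𝔘 hν
      (Event.ofSeq 𝔘 ν N (fun _ => Set.univ) fun _ => .univ)
    rwa [Event.toSet_ofSeq_univ, Event.st_internalMeasure_univ 𝔘 hν, ENNReal.ofReal_one] at this
  · rw [loebMeasure_apply 𝔘 MeasurableSet.univ]
    exact one_le_loebOuter_univ 𝔘 h𝔘 hν

/-- The Loeb measure extends `st ∘ ν_N`: it is at most `st ∘ ν_N` on an internal set and on its
complement, and the space has measure `1`. -/
theorem Event.loebMeasure_toSet [Nonempty (Σ n, Ω n)]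
    (h𝔘 : 𝔘.IsSaturated (Cardinal.aleph 1))
    (hν : ∀ᶠ n in (𝔘.typ N : Filter ℕ), IsProbabilityMeasure (ν n)) (B : 𝔘.Event ν N) :
    𝔘.loebMeasure ν N (Event.toSet 𝔘 B) = ENNReal.ofReal (𝔘.st (𝔘.internalMeasure B)) := by
  have := isProbabilityMeasure_loebMeasure 𝔘 h𝔘 hν
  have hle := Event.loebMeasure_toSet_le 𝔘 hν
  refine (hle B).antisymm ?_
  obtain ⟨D, D', hD, hD', h⟩ := Event.exists_inter_diff 𝔘 hν
    (Event.ofSeq 𝔘 ν N (fun _ => Set.univ) fun _ => .univ) B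
  rw [Event.toSet_ofSeq_univ, Set.univ_inter] at hD
  rw [Event.toSet_ofSeq_univ, ← Set.compl_eq_univ_sdiff] at hD'
  rw [Event.st_internalMeasure_univ 𝔘 hν] at h
  have hDB : 𝔘.st (𝔘.internalMeasure B) = 𝔘.st (𝔘.internalMeasure D) :=
    (Event.st_internalMeasure_mono 𝔘 hν hD.ge).antisymm (Event.st_internalMeasure_mono 𝔘 hν hD.le)
  have hc := hle D'
  rw [hD', prob_compl_eq_one_sub (Event.measurableSet_toSet 𝔘 hν B), tsub_le_iff_right] at hc
  have h0 := Event.st_internalMeasure_nonneg 𝔘 hν D'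
  have : ENNReal.ofReal (𝔘.st (𝔘.internalMeasure D')) +
      ENNReal.ofReal (𝔘.st (𝔘.internalMeasure B)) = 1 := by
    rw [← ENNReal.ofReal_add h0 (Event.st_internalMeasure_nonneg 𝔘 hν B), hDB, add_comm, h,
      ENNReal.ofReal_one]
  rw [← this] at hc
  exact (ENNReal.add_le_add_iff_left ENNReal.ofReal_ne_top).1 hc

end NonstandardExtension

/-! ### The standard part of an internal function on the Loeb space -/

namespace NonstandardExtension

variable (𝔘 : NonstandardExtension.{u})
variable {Ω : ℕ → Type} [∀ n, MeasurableSpace (Ω n)] {ν : ∀ n, Measure (Ω n)} {N : 𝔘.star ℕ}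

/-- Changing `f_n` on `ν_n`-null sets changes `*f` on a Loeb null set only. -/
theorem ae_starFun_eq (hν : ∀ᶠ n in (𝔘.typ N : Filter ℕ), IsProbabilityMeasure (ν n))
    {f g : ∀ n, Ω n → ℝ} (h : ∀ᶠ n in (𝔘.typ N : Filter ℕ), f n =ᵐ[ν n] g n) :
    ∀ᵐ x ∂(𝔘.loebMeasure ν N), 𝔘.starFun ν N f x = 𝔘.starFun ν N g x := by
  -- the sets `{f_n ≠ g_n}` need not be measurable, so they are covered by measurable null sets
  let B := Event.ofSeq 𝔘 ν N (fun n => toMeasurable (ν n) {ω | f n ω ≠ g n ω})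
    fun n => measurableSet_toMeasurable _ _
  have hB : 𝔘.st (𝔘.internalMeasure B) = 0 := by
    refine Event.st_internalMeasure_ofSeq 𝔘 hν (tendsto_const_nhds.congr' ?_)
    filter_upwards [h] with n hn
    rw [measureReal_def, measure_toMeasurable, ae_iff.1 hn, ENNReal.toReal_zero]
  refine measure_mono_null (t := Event.toSet 𝔘 B) (fun x hx => ?_) (le_antisymm ?_ zero_le)
  · have hx' : ¬ ∀ᶠ a in (𝔘.typ x.1).toFilter, f a.1 a.2 = g a.1 a.2 := by
      rwa [← starMap_eq_iff]
    rw [← Ultrafilter.eventually_not] at hx'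
    exact (Event.mem_ofSeq 𝔘).2 (hx'.mono fun a ha => subset_toMeasurable _ _ ha)
  · refine (Event.loebMeasure_toSet_le 𝔘 hν B).trans ?_
    rw [hB, ENNReal.ofReal_zero]

section Law

variable {f : ∀ n, Ω n → ℝ} (hf : ∀ n, Measurable (f n)) {μ : Measure ℝ}

theorem loebMeasure_preimage [Nonempty (Σ n, Ω n)] (h𝔘 : 𝔘.IsSaturated (Cardinal.aleph 1))
    (hν : ∀ᶠ n in (𝔘.typ N : Filter ℕ), IsProbabilityMeasure (ν n)) [IsProbabilityMeasure μ]
    {S : Set ℝ} (hS : MeasurableSet S)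
    (h : Tendsto (fun n => (ν n).real (f n ⁻¹' S)) (𝔘.typ N) (𝓝 (μ.real S))) :
    𝔘.loebMeasure ν N
      (Event.toSet 𝔘 (Event.ofSeq 𝔘 ν N (fun n => f n ⁻¹' S) fun n => hf n hS)) = μ S := by
  rw [Event.loebMeasure_toSet 𝔘 h𝔘 hν, Event.st_internalMeasure_ofSeq 𝔘 hν h,
    ofReal_measureReal]

include hf in
/-- If the laws of `f_n` converge on Borel sets to a probability measure on `ℝ`, then `*f` is
almost everywhere finite. -/
theorem ae_isFinite_starFun [Nonempty (Σ n, Ω n)] (h𝔘 : 𝔘.IsSaturated (Cardinal.aleph 1))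
    (hν : ∀ᶠ n in (𝔘.typ N : Filter ℕ), IsProbabilityMeasure (ν n)) [IsProbabilityMeasure μ]
    (h : ∀ S, MeasurableSet S →
      Tendsto (fun n => (ν n).real (f n ⁻¹' S)) (𝔘.typ N) (𝓝 (μ.real S))) :
    ∀ᵐ x ∂(𝔘.loebMeasure ν N), 𝔘.IsFinite (𝔘.starFun ν N f x) := by
  have hS : ∀ m : ℕ, MeasurableSet {y : ℝ | (m : ℝ) < |y|} := fun m =>
    measurableSet_lt measurable_const measurable_norm
  have hlim : Tendsto (fun m : ℕ => μ {y : ℝ | (m : ℝ) < |y|}) atTop (𝓝 0) := by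
    have hemp : ⋂ m : ℕ, {y : ℝ | (m : ℝ) < |y|} = ∅ :=
      Set.eq_empty_of_forall_notMem fun y hy => by
        obtain ⟨m, hm⟩ := exists_nat_ge |y|
        exact (lt_of_lt_of_le (Set.mem_iInter.1 hy m) hm).false
    rw [← measure_empty (μ := μ), ← hemp]
    refine tendsto_measure_iInter_atTop (fun m => (hS m).nullMeasurableSet)
      (fun m n hmn y (hy : (n : ℝ) < |y|) => ?_) ⟨0, measure_ne_top _ _⟩
    exact lt_of_le_of_lt (Nat.cast_le.2 hmn) hy
  refine le_antisymm (ge_of_tendsto' hlim fun m => ?_) zero_le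
  rw [← loebMeasure_preimage 𝔘 hf h𝔘 hν (hS m) (h _ (hS m))]
  refine measure_mono fun x hx => (Event.mem_ofSeq 𝔘).2 ?_
  by_contra hcon
  rw [← Ultrafilter.eventually_not] at hcon
  exact hx (𝔘.isFinite_starMap.2 ⟨m, hcon.mono fun a ha => not_lt.1 ha⟩)

include hf in
theorem measurableSet_isFinite_starFun
    (hν : ∀ᶠ n in (𝔘.typ N : Filter ℕ), IsProbabilityMeasure (ν n)) :
    MeasurableSet {x : 𝔘.Space ν N | 𝔘.IsFinite (𝔘.starFun ν N f x)} := by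
  have hS : ∀ m : ℕ, MeasurableSet {y : ℝ | |y| ≤ m} := fun m =>
    measurableSet_le measurable_norm measurable_const
  have : {x : 𝔘.Space ν N | 𝔘.IsFinite (𝔘.starFun ν N f x)} = ⋃ m : ℕ, Event.toSet 𝔘
      (Event.ofSeq 𝔘 ν N (fun n => f n ⁻¹' {y : ℝ | |y| ≤ m}) fun n => hf n (hS m)) := by
    ext x
    refine (𝔘.isFinite_starMap).trans ?_
    rw [Set.mem_iUnion]
    constructor
    · rintro ⟨r, hr⟩
      obtain ⟨m, hm⟩ := exists_nat_ge r
      exact ⟨m, (Event.mem_ofSeq 𝔘).2 (hr.mono fun a ha => ha.trans hm)⟩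
    · rintro ⟨m, hm⟩
      exact ⟨m, (Event.mem_ofSeq 𝔘).1 hm⟩
  rw [this]
  exact MeasurableSet.iUnion fun m => Event.measurableSet_toSet 𝔘 hν _

theorem tendsto_st_starFun {x : 𝔘.Space ν N} (hx : 𝔘.IsFinite (𝔘.starFun ν N f x)) :
    Tendsto (fun a : Σ n, Ω n => f a.1 a.2) (𝔘.typ x.1) (𝓝 (𝔘.st (𝔘.starFun ν N f x))) :=
  𝔘.isNear_starMap.1 (IsFinite.isNear_st 𝔘 hx)

theorem st_le_of_mem {x : 𝔘.Space ν N} (hx : 𝔘.IsFinite (𝔘.starFun ν N f x)) {a : ℝ}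
    (h : x ∈ Event.toSet 𝔘
      (Event.ofSeq 𝔘 ν N (fun n => f n ⁻¹' Set.Iic a) fun n => hf n measurableSet_Iic)) :
    𝔘.st (𝔘.starFun ν N f x) ≤ a :=
  le_of_tendsto (tendsto_st_starFun 𝔘 hx) ((Event.mem_ofSeq 𝔘).1 h)

theorem mem_of_st_lt {x : 𝔘.Space ν N} (hx : 𝔘.IsFinite (𝔘.starFun ν N f x)) {a : ℝ}
    (h : 𝔘.st (𝔘.starFun ν N f x) < a) :
    x ∈ Event.toSet 𝔘
      (Event.ofSeq 𝔘 ν N (fun n => f n ⁻¹' Set.Iic a) fun n => hf n measurableSet_Iic) :=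
  (Event.mem_ofSeq 𝔘).2 (((tendsto_st_starFun 𝔘 hx).eventually (gt_mem_nhds h)).mono
    fun _ h => le_of_lt h)

include hf in
theorem measurable_st_starFun
    (hν : ∀ᶠ n in (𝔘.typ N : Filter ℕ), IsProbabilityMeasure (ν n)) :
    Measurable fun x : 𝔘.Space ν N => 𝔘.st (𝔘.starFun ν N f x) := by
  refine measurable_of_Iic fun a => ?_
  let E : ℕ → Set (𝔘.Space ν N) := fun m => Event.toSet 𝔘 (Event.ofSeq 𝔘 ν N
    (fun n => f n ⁻¹' Set.Iic (a + 1 / ((m : ℝ) + 1))) fun n => hf n measurableSet_Iic)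
  let G := {x : 𝔘.Space ν N | 𝔘.IsFinite (𝔘.starFun ν N f x)}
  have hG : MeasurableSet G := measurableSet_isFinite_starFun 𝔘 hf hν
  have hE : MeasurableSet (G ∩ ⋂ m, E m) :=
    hG.inter (MeasurableSet.iInter fun m => Event.measurableSet_toSet 𝔘 hν _)
  -- on the complement of `G` the standard part has the junk value `0`
  have key : (fun x : 𝔘.Space ν N => 𝔘.st (𝔘.starFun ν N f x)) ⁻¹' Set.Iic a =
      (G ∩ ⋂ m, E m) ∪ {x | x ∈ Gᶜ ∧ 0 ≤ a} := by
    ext x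
    by_cases hx : x ∈ G
    · simp only [Set.mem_preimage, Set.mem_Iic, Set.mem_union, Set.mem_inter_iff, hx, true_and,
        Set.mem_iInter, Set.mem_ofPred_eq, Set.mem_compl_iff, not_true_eq_false, false_and,
        or_false]
      constructor
      · intro h m
        refine mem_of_st_lt 𝔘 hf hx (lt_of_le_of_lt h ?_)
        have : (0 : ℝ) < 1 / ((m : ℝ) + 1) := by positivity
        linarith
      · intro h
        refine ge_of_tendsto' (x := atTop) (f := fun m : ℕ => a + 1 / ((m : ℝ) + 1)) ?_
          fun m => st_le_of_mem 𝔘 hf hx (h m)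
        simpa using tendsto_const_nhds.add (tendsto_one_div_add_atTop_nhds_zero_nat (𝕜 := ℝ))
    · have : 𝔘.st (𝔘.starFun ν N f x) = 0 := 𝔘.st_of_not_isFinite hx
      simp only [Set.mem_preimage, Set.mem_Iic, this, Set.mem_union, Set.mem_inter_iff, hx,
        false_and, Set.mem_ofPred_eq, Set.mem_compl_iff, not_false_eq_true, true_and, false_or]
  rw [key]
  refine hE.union ?_
  by_cases ha : 0 ≤ a
  · rw [show {x | x ∈ Gᶜ ∧ 0 ≤ a} = Gᶜ from Set.ext fun _ => and_iff_left ha]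
    exact hG.compl
  · simp [ha]

include hf in
/-- If the laws of `f_n` converge on Borel sets to a probability measure `μ` on `ℝ`, then
`st(*f)` has law `μ` under the Loeb measure: `{st(*f) ≤ a}` lies between the internal sets
`{*f ≤ a}` and `{*f ≤ a + ε}`, up to the null set where `*f` is infinite. -/
theorem map_st_starFun [Nonempty (Σ n, Ω n)] (h𝔘 : 𝔘.IsSaturated (Cardinal.aleph 1))
    (hν : ∀ᶠ n in (𝔘.typ N : Filter ℕ), IsProbabilityMeasure (ν n)) [IsProbabilityMeasure μ]
    (h : ∀ S, MeasurableSet S →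
      Tendsto (fun n => (ν n).real (f n ⁻¹' S)) (𝔘.typ N) (𝓝 (μ.real S))) :
    (𝔘.loebMeasure ν N).map (fun x => 𝔘.st (𝔘.starFun ν N f x)) = μ := by
  have := isProbabilityMeasure_loebMeasure 𝔘 h𝔘 hν
  have hm := measurable_st_starFun 𝔘 hf (ν := ν) (N := N) hν
  have hfin := ae_isFinite_starFun 𝔘 hf h𝔘 hν h
  have hE := fun a : ℝ => loebMeasure_preimage 𝔘 hf h𝔘 hν (measurableSet_Iic (a := a))
    (h _ measurableSet_Iic)
  have := Measure.isProbabilityMeasure_map (μ := 𝔘.loebMeasure ν N) hm.aemeasurable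
  refine Measure.ext_of_Iic _ _ fun a => ?_
  rw [Measure.map_apply hm measurableSet_Iic]
  refine le_antisymm ?_ ?_
  · have hlim : Tendsto (fun m : ℕ => μ (Set.Iic (a + 1 / ((m : ℝ) + 1)))) atTop
        (𝓝 (μ (Set.Iic a))) := by
      have hI : ⋂ m : ℕ, Set.Iic (a + 1 / ((m : ℝ) + 1)) = Set.Iic a := by
        ext y
        simp only [Set.mem_iInter, Set.mem_Iic]
        constructor
        · intro h
          refine ge_of_tendsto' (x := atTop) (f := fun m : ℕ => a + 1 / ((m : ℝ) + 1)) ?_ h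
          simpa using tendsto_const_nhds.add (tendsto_one_div_add_atTop_nhds_zero_nat (𝕜 := ℝ))
        · intro h m
          have : (0 : ℝ) < 1 / ((m : ℝ) + 1) := by positivity
          linarith
      rw [← hI]
      refine tendsto_measure_iInter_atTop (fun m => measurableSet_Iic.nullMeasurableSet)
        (fun m n hmn => Set.Iic_subset_Iic.2 ?_) ⟨0, measure_ne_top _ _⟩
      have := Nat.one_div_le_one_div (α := ℝ) hmn
      linarith
    refine ge_of_tendsto' hlim fun m => ?_
    rw [← hE]
    refine measure_mono_ae ?_
    filter_upwards [hfin] with x hx hxa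
    refine mem_of_st_lt 𝔘 hf hx (lt_of_le_of_lt hxa ?_)
    have : (0 : ℝ) < 1 / ((m : ℝ) + 1) := by positivity
    linarith
  · rw [← hE]
    refine measure_mono_ae ?_
    filter_upwards [hfin] with x hx hxa
    exact st_le_of_mem 𝔘 hf hx hxa

end Law

/-- `S`-integrability from bounds that hold along the ultrafilter of `N`. -/
theorem SIntegrable.of_eventually {f : ∀ n, Ω n → ℝ} {C : ℝ}
    (hint : ∀ᶠ n in (𝔘.typ N : Filter ℕ), Integrable (f n) (ν n))
    (hfin : ∀ᵐ x ∂(𝔘.loebMeasure ν N), 𝔘.IsFinite (𝔘.starFun ν N f x))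
    (hC : ∀ᶠ n in (𝔘.typ N : Filter ℕ), ∫ ω, |f n ω| ∂(ν n) ≤ C)
    (hui : ∀ ε > 0, ∃ δ > 0, ∀ᶠ n in (𝔘.typ N : Filter ℕ), ∀ B, MeasurableSet B →
      (ν n).real B < δ → ∫ ω in B, |f n ω| ∂(ν n) < ε) :
    𝔘.SIntegrable ν N f where
  starIntegrable := hint
  ae_finite := hfin
  finite_integral := 𝔘.isFinite_starMap.2 ⟨C, hC.mono fun n hn => by
    rwa [abs_of_nonneg (integral_nonneg fun _ => abs_nonneg _)]⟩
  near_zero B hB := by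
    rw [internalMeasure, isNear_starMap] at hB
    rw [starIntegralAbs, isNear_starMap, Metric.tendsto_nhds]
    intro ε hε
    obtain ⟨δ, hδ, h⟩ := hui ε hε
    filter_upwards [Event.eventually 𝔘 h B, Metric.tendsto_nhds.1 hB δ hδ] with S hS hS'
    rw [Real.dist_0_eq_abs, abs_of_nonneg measureReal_nonneg] at hS'
    rw [Real.dist_0_eq_abs, abs_of_nonneg (integral_nonneg fun _ => abs_nonneg _)]
    exact hS _ S.2.2 hS'

end NonstandardExtension

/-! ### The law of the first coordinates on a sphere -/

section Cone

variable {E : Type*} [NormedAddCommGroup E] [InnerProductSpace ℝ E] [FiniteDimensional ℝ E]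
  [MeasurableSpace E] [BorelSpace E]
  {F : Type*} [NormedAddCommGroup F] [InnerProductSpace ℝ F] [FiniteDimensional ℝ F]
  [MeasurableSpace F] [BorelSpace F]

open Module

theorem lintegral_comp_smul_of_pos {r : ℝ} (hr : 0 < r) {g : E → ENNReal} (hg : Measurable g) :
    ∫⁻ x, g (r • x) = ENNReal.ofReal ((r ^ finrank ℝ E)⁻¹) * ∫⁻ x, g x := by
  have h := Measure.map_addHaar_smul (volume : Measure E) hr.ne'
  rw [abs_of_pos (by positivity)] at h
  rw [← lintegral_map hg (measurable_const_smul r), h, lintegral_smul_measure, smul_eq_mul]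

theorem lintegral_eq_mul_lintegral_comp_smul {r : ℝ} (hr : 0 < r) {g : E → ENNReal}
    (hg : Measurable g) :
    ∫⁻ x, g x = ENNReal.ofReal (r ^ finrank ℝ E) * ∫⁻ x, g (r • x) := by
  rw [lintegral_comp_smul_of_pos hr hg, ← mul_assoc, ← ENNReal.ofReal_mul (by positivity),
    mul_inv_cancel₀ (by positivity), ENNReal.ofReal_one, one_mul]

/-- The law of `(1 + ‖w‖²)^{-1/2} w`, `w = y / ‖z‖`, for `(y, z)` uniform in the unit ball of
`E × F`. -/
theorem setLIntegral_ball_prod [Nontrivial F] {φ : E → ENNReal} (hφ : Measurable φ) :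
    ∫⁻ p : E × F in {p | ‖p.1‖ ^ 2 + ‖p.2‖ ^ 2 < 1}, φ ((√(‖p.1‖ ^ 2 + ‖p.2‖ ^ 2))⁻¹ • p.1) =
      (∫⁻ z : F in ball 0 1, ENNReal.ofReal (‖z‖ ^ finrank ℝ E)) *
        ∫⁻ w : E, ENNReal.ofReal ((√(1 + ‖w‖ ^ 2))⁻¹ ^ (finrank ℝ E + finrank ℝ F)) *
          φ ((√(1 + ‖w‖ ^ 2))⁻¹ • w) := by
  have hS : MeasurableSet {p : E × F | ‖p.1‖ ^ 2 + ‖p.2‖ ^ 2 < 1} :=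
    measurableSet_lt (by fun_prop) measurable_const
  set G : E × F → ENNReal := {p | ‖p.1‖ ^ 2 + ‖p.2‖ ^ 2 < 1}.indicator
    fun p => φ ((√(‖p.1‖ ^ 2 + ‖p.2‖ ^ 2))⁻¹ • p.1) with hG
  have hGm : Measurable G := Measurable.indicator (hφ.comp (by fun_prop)) hS
  set H : F → ENNReal := (ball 0 1).indicator fun z => ENNReal.ofReal (‖z‖ ^ finrank ℝ E) with hH
  have hHm : Measurable H := Measurable.indicator (by fun_prop) measurableSet_ball
  -- for `z ≠ 0` the substitution `y = ‖z‖ w` separates the radius from the direction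
  have h₁ : ∀ z : F, z ≠ 0 → ∫⁻ y, G (y, z) = ∫⁻ w : E,
      (ENNReal.ofReal ((√(1 + ‖w‖ ^ 2))⁻¹ ^ finrank ℝ E) * φ ((√(1 + ‖w‖ ^ 2))⁻¹ • w)) *
        H (√(1 + ‖w‖ ^ 2) • z) := by
    intro z hz
    have hz' : 0 < ‖z‖ := norm_pos_iff.2 hz
    rw [lintegral_eq_mul_lintegral_comp_smul hz' (g := fun y => G (y, z))
      (hGm.comp measurable_prodMk_right),
      ← lintegral_const_mul (f := fun w : E => G (‖z‖ • w, z)) _ (hGm.comp (by fun_prop))]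
    refine lintegral_congr fun w => ?_
    have hs : 0 < √(1 + ‖w‖ ^ 2) := Real.sqrt_pos.2 (by positivity)
    have hsq : ‖(‖z‖ • w, z).1‖ ^ 2 + ‖(‖z‖ • w, z).2‖ ^ 2 = (√(1 + ‖w‖ ^ 2) * ‖z‖) ^ 2 := by
      rw [mul_pow, Real.sq_sqrt (by positivity), norm_smul, norm_norm]
      ring
    have hmem : (‖z‖ • w, z) ∈ {p : E × F | ‖p.1‖ ^ 2 + ‖p.2‖ ^ 2 < 1} ↔
        √(1 + ‖w‖ ^ 2) • z ∈ ball (0 : F) 1 := by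
      rw [Set.mem_ofPred_eq, hsq, mem_ball_zero_iff, norm_smul, Real.norm_of_nonneg hs.le,
        sq_lt_one_iff₀ (by positivity)]
    by_cases h : √(1 + ‖w‖ ^ 2) • z ∈ ball (0 : F) 1
    · rw [hG, hH, Set.indicator_of_mem h, Set.indicator_of_mem (hmem.2 h), hsq,
        Real.sqrt_sq (by positivity), norm_smul, Real.norm_of_nonneg hs.le, smul_smul, mul_comm,
        mul_right_comm, ← ENNReal.ofReal_mul (by positivity), mul_comm]
      congr 2
      · rw [mul_pow, ← mul_assoc, ← mul_pow, inv_mul_cancel₀ hs.ne', one_pow, one_mul]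
      · congr 1
        field_simp
    · rw [hG, hH, Set.indicator_of_notMem h,
        Set.indicator_of_notMem (fun h' => h (hmem.1 h')), mul_zero, mul_zero]
  have hψ : Measurable fun w : E => ENNReal.ofReal
      ((√(1 + ‖w‖ ^ 2))⁻¹ ^ (finrank ℝ E + finrank ℝ F)) * φ ((√(1 + ‖w‖ ^ 2))⁻¹ • w) :=
    Measurable.mul (by fun_prop) (hφ.comp (by fun_prop))
  have hK : Measurable fun p : F × E =>
      (ENNReal.ofReal ((√(1 + ‖p.2‖ ^ 2))⁻¹ ^ finrank ℝ E) * φ ((√(1 + ‖p.2‖ ^ 2))⁻¹ • p.2)) *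
        H (√(1 + ‖p.2‖ ^ 2) • p.1) :=
    (Measurable.mul (by fun_prop) (hφ.comp (by fun_prop))).mul (hHm.comp (by fun_prop))
  rw [← lintegral_indicator hS, ← hG, Measure.volume_eq_prod, lintegral_prod_symm' _ hGm]
  rw [lintegral_congr_ae (g := fun z : F => ∫⁻ w : E,
      (ENNReal.ofReal ((√(1 + ‖w‖ ^ 2))⁻¹ ^ finrank ℝ E) * φ ((√(1 + ‖w‖ ^ 2))⁻¹ • w)) *
        H (√(1 + ‖w‖ ^ 2) • z))
    ((Measure.ae_ne volume (0 : F)).mono h₁), lintegral_lintegral_swap hK.aemeasurable,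
    ← lintegral_const_mul _ hψ]
  refine lintegral_congr fun w => ?_
  have hs : 0 < √(1 + ‖w‖ ^ 2) := Real.sqrt_pos.2 (by positivity)
  rw [lintegral_const_mul (f := fun z : F => H (√(1 + ‖w‖ ^ 2) • z)) _
      (hHm.comp (measurable_const_smul _)),
    lintegral_comp_smul_of_pos hs hHm, hH, lintegral_indicator measurableSet_ball, pow_add,
    ENNReal.ofReal_mul (by positivity), inv_pow, inv_pow]
  ring

/-- The change of variables `w = (1 - ‖x‖²)^{-1/2} x` from the unit ball to the whole space. -/
theorem lintegral_eq_setLIntegral_ball {g : E → ENNReal} :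
    ∫⁻ w, g w = ∫⁻ x in ball (0 : E) 1,
      ENNReal.ofReal ((√(1 - ‖x‖ ^ 2))⁻¹ ^ (finrank ℝ E + 2)) *
        g ((√(1 - ‖x‖ ^ 2))⁻¹ • x) := by
  let e := (OpenPartialHomeomorph.univUnitBall (E := E)).symm
  have himg : e '' ball 0 1 = Set.univ := e.image_source_eq_target
  have happ : ∀ x, e x = (√(1 - ‖x‖ ^ 2))⁻¹ • x := fun x => rfl
  -- the derivative is a multiple of a transvection, which gives its determinant
  let e' : E → E →L[ℝ] E := fun x => (√(1 - ‖x‖ ^ 2))⁻¹ • ContinuousLinearMap.id ℝ E +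
    ((√(1 - ‖x‖ ^ 2))⁻¹ ^ 3 • innerSL ℝ x).smulRight x
  have hpos : ∀ x ∈ ball (0 : E) 1, 0 < 1 - ‖x‖ ^ 2 := fun x hx => by
    have := mem_ball_zero_iff.1 hx
    nlinarith [norm_nonneg x]
  have hder : ∀ x ∈ ball (0 : E) 1, HasFDerivWithinAt e (e' x) (ball 0 1) x := by
    intro x hx
    have hp := hpos x hx
    have hs : 0 < √(1 - ‖x‖ ^ 2) := Real.sqrt_pos.2 hp
    have h1 : HasFDerivAt (fun x : E => 1 - ‖x‖ ^ 2) (-(2 • innerSL ℝ x)) x := by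
      simpa using (hasStrictFDerivAt_norm_sq x).hasFDerivAt.const_sub 1
    have h2 := ((Real.hasDerivAt_sqrt hp.ne').inv hs.ne').comp_hasFDerivAt x h1
    have h3 := h2.smul (hasFDerivAt_id x)
    have h4 : HasFDerivAt e _ x := h3
    refine (h4.congr_fderiv ?_).hasFDerivWithinAt
    ext v
    simp [e']
    rw [← neg_smul]
    congr 1
    field_simp
  have hdet : ∀ x ∈ ball (0 : E) 1, (e' x).det = (√(1 - ‖x‖ ^ 2))⁻¹ ^ (finrank ℝ E + 2) := by
    intro x hx
    have hp := hpos x hx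
    have hs : 0 < √(1 - ‖x‖ ^ 2) := Real.sqrt_pos.2 hp
    have : ((e' x : E →L[ℝ] E) : E →ₗ[ℝ] E) = (√(1 - ‖x‖ ^ 2))⁻¹ • LinearMap.transvection
        (((√(1 - ‖x‖ ^ 2))⁻¹ ^ 2 • innerSL ℝ x : E →L[ℝ] ℝ) : E →ₗ[ℝ] ℝ) x := by
      ext v
      simp [e', LinearMap.transvection]
      rw [smul_smul]
      congr 1
      field_simp
    rw [ContinuousLinearMap.det, this, LinearMap.det_smul, LinearMap.transvection.det, pow_add]
    congr 1
    simp
    rw [Real.sq_sqrt hp.le]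
    field_simp
    ring
  rw [← setLIntegral_univ, ← himg, lintegral_image_eq_lintegral_abs_det_fderiv_mul volume
    measurableSet_ball hder e.injOn]
  refine setLIntegral_congr_fun measurableSet_ball fun x hx => ?_
  simp only [hdet x hx, happ]
  rw [abs_of_nonneg (by positivity)]

end Cone

section Cone

variable {E : Type*} [NormedAddCommGroup E] [InnerProductSpace ℝ E] [FiniteDimensional ℝ E]
  [MeasurableSpace E] [BorelSpace E]
  {F : Type*} [NormedAddCommGroup F] [InnerProductSpace ℝ F] [FiniteDimensional ℝ F]
  [MeasurableSpace F] [BorelSpace F]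

open Module

/-- The law of `y / ‖(y, z)‖` for `(y, z)` uniform in the unit ball of `E × F` has density
proportional to `(1 - ‖x‖²)^{(dim F - 2) / 2}` on the unit ball of `E`. -/
theorem setLIntegral_ball_prod_eq_setLIntegral_ball {j : ℕ} (hj : finrank ℝ F = j + 2)
    {φ : E → ENNReal} (hφ : Measurable φ) :
    ∫⁻ p : E × F in {p | ‖p.1‖ ^ 2 + ‖p.2‖ ^ 2 < 1}, φ ((√(‖p.1‖ ^ 2 + ‖p.2‖ ^ 2))⁻¹ • p.1) =
      (∫⁻ z : F in ball 0 1, ENNReal.ofReal (‖z‖ ^ finrank ℝ E)) *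
        ∫⁻ x : E in ball 0 1, ENNReal.ofReal (√(1 - ‖x‖ ^ 2) ^ j) * φ x := by
  have : Nontrivial F := nontrivial_of_finrank_pos (R := ℝ) (by omega)
  rw [setLIntegral_ball_prod hφ, lintegral_eq_setLIntegral_ball, hj]
  congr 1
  refine setLIntegral_congr_fun measurableSet_ball fun x hx => ?_
  have hp : 0 < 1 - ‖x‖ ^ 2 := by
    have := mem_ball_zero_iff.1 hx
    nlinarith [norm_nonneg x]
  have hs : 0 < √(1 - ‖x‖ ^ 2) := Real.sqrt_pos.2 hp
  have h : √(1 + ‖(√(1 - ‖x‖ ^ 2))⁻¹ • x‖ ^ 2) = (√(1 - ‖x‖ ^ 2))⁻¹ := by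
    rw [Real.sqrt_eq_iff_eq_sq (by positivity) (by positivity), norm_smul,
      Real.norm_of_nonneg (by positivity), mul_pow, inv_pow, Real.sq_sqrt hp.le]
    field_simp
    ring
  simp only [h, inv_inv, smul_smul, mul_inv_cancel₀ hs.ne', one_smul]
  rw [← mul_assoc, ← ENNReal.ofReal_mul (by positivity)]
  congr 2
  rw [inv_pow, show finrank ℝ E + (j + 2) = (finrank ℝ E + 2) + j by ring,
    pow_add _ (finrank ℝ E + 2), inv_mul_cancel_left₀ (by positivity)]

end Cone

section Sphere

open Module
open scoped Pointwise

/-- The isometric splitting `ℝ^{k+m} = ℝᵏ × ℝᵐ` into the first `k` and the last `m` coordinates. -/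
noncomputable def splitCoords (k m : ℕ) : EuclideanSpace ℝ (Fin (k + m)) ≃ₗᵢ[ℝ]
    WithLp 2 (EuclideanSpace ℝ (Fin k) × EuclideanSpace ℝ (Fin m)) :=
  (LinearIsometryEquiv.piLpCongrLeft 2 ℝ ℝ finSumFinEquiv.symm).trans
    (PiLp.sumPiLpEquivProdLpPiLp 2 fun _ => ℝ)

theorem measurePreserving_splitCoords (k m : ℕ) :
    MeasurePreserving fun x : EuclideanSpace ℝ (Fin (k + m)) =>
      WithLp.ofLp (splitCoords k m x) :=
  (WithLp.volume_preserving_ofLp _ _).comp (splitCoords k m).measurePreserving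

theorem splitCoords_fst (k m : ℕ) (x : EuclideanSpace ℝ (Fin (k + m))) :
    (WithLp.ofLp (splitCoords k m x)).1 = firstCoords k x := by
  ext i
  have : (i : ℕ) < k + m := i.2.trans_le (Nat.le_add_right _ _)
  simp [splitCoords, firstCoords, this]
  rfl

theorem norm_eq_splitCoords (k m : ℕ) (x : EuclideanSpace ℝ (Fin (k + m))) :
    ‖x‖ = √(‖(WithLp.ofLp (splitCoords k m x)).1‖ ^ 2 +
      ‖(WithLp.ofLp (splitCoords k m x)).2‖ ^ 2) := by
  rw [← (splitCoords k m).norm_map x, WithLp.prod_norm_eq_of_L2]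
  rfl

theorem firstCoords_smul (k : ℕ) {n : ℕ} (r : ℝ) (x : EuclideanSpace ℝ (Fin n)) :
    firstCoords k (r • x) = r • firstCoords k x := by
  ext i
  by_cases h : (i : ℕ) < n <;> simp [firstCoords, h]

theorem continuous_firstCoords (k n : ℕ) :
    Continuous (firstCoords k : EuclideanSpace ℝ (Fin n) → EuclideanSpace ℝ (Fin k)) := by
  refine (PiLp.continuous_toLp 2 _).comp (continuous_pi fun i => ?_)
  by_cases h : (i : ℕ) < n
  · simp only [h, dite_true]
    fun_prop
  · simp only [h, dite_false]
    fun_prop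

theorem measurable_firstCoords_coe (k n : ℕ) :
    Measurable fun x : RootSphere n => firstCoords k (x : EuclideanSpace ℝ (Fin n)) :=
  ((continuous_firstCoords k n).comp continuous_subtype_val).measurable

theorem measurable_dilateSphere (n : ℕ) : Measurable (dilateSphere n) :=
  Continuous.measurable (Continuous.subtype_mk (by fun_prop) _)

theorem isProbabilityMeasure_sphereMeasure {n : ℕ} (hn : n ≠ 0) :
    IsProbabilityMeasure (sphereMeasure n) := by
  have : Nontrivial (EuclideanSpace ℝ (Fin n)) :=
    Module.nontrivial_of_finrank_pos (R := ℝ) (by simpa using Nat.pos_of_ne_zero hn)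
  have h0 : (volume : Measure (EuclideanSpace ℝ (Fin n))).toSphere Set.univ ≠ 0 :=
    Measure.measure_univ_ne_zero.2 (Measure.toSphere_ne_zero _)
  refine @Measure.isProbabilityMeasure_map _ _ _ _ _ ⟨?_⟩ _
    (measurable_dilateSphere n).aemeasurable
  rw [Measure.smul_apply, smul_eq_mul]
  exact ENNReal.inv_mul_cancel h0 (measure_ne_top _ _)

/-- The cone over a subset of the unit sphere, which computes its surface measure. -/
theorem Ioo_smul_coe_image {V : Type*} [NormedAddCommGroup V] [NormedSpace ℝ V]
    (T : Set V) : Set.Ioo (0 : ℝ) 1 • (Subtype.val '' {x : sphere (0 : V) 1 | (x : V) ∈ T}) =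
      {x : V | ‖x‖ < 1 ∧ ‖x‖⁻¹ • x ∈ T} \ {0} := by
  ext x
  constructor
  · rintro ⟨r, hr, _, ⟨y, hy, rfl⟩, rfl⟩
    have hy1 : ‖(y : V)‖ = 1 := mem_sphere_zero_iff_norm.1 y.2
    have hn : ‖r • (y : V)‖ = r := by rw [norm_smul, Real.norm_of_nonneg hr.1.le, hy1, mul_one]
    refine ⟨⟨?_, ?_⟩, ?_⟩
    · simpa only [hn] using hr.2
    · have hy' : (y : V) ∈ T := hy
      simpa only [hn, smul_smul, inv_mul_cancel₀ hr.1.ne', one_smul] using hy'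
    · exact norm_ne_zero_iff.1 (hn.trans_ne hr.1.ne')
  · rintro ⟨⟨h1, hT⟩, h0⟩
    have h0' : 0 < ‖x‖ := norm_pos_iff.2 h0
    exact ⟨‖x‖, ⟨h0', h1⟩, _, ⟨⟨‖x‖⁻¹ • x, by simp [norm_smul, h0'.ne']⟩, hT, rfl⟩,
      smul_inv_smul₀ h0'.ne' x⟩

/-- The law of the first `k` coordinates on `S^{n-1}(√n)`, `n = k + j + 2`, has a density
proportional to `(1 - ‖u‖² / n)^{j/2}` on `‖u‖ ≤ √n`; outside of this ball the square root below
is `0`. -/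
theorem exists_map_firstCoords_sphereMeasure (k : ℕ) {j : ℕ} (hj : j ≠ 0) :
    ∃ c : ENNReal, (sphereMeasure (k + (j + 2))).map
      (fun x : RootSphere (k + (j + 2)) => firstCoords k x.1) =
      c • (volume : Measure (EuclideanSpace ℝ (Fin k))).withDensity fun u =>
        ENNReal.ofReal (√(1 - ‖u‖ ^ 2 / (k + (j + 2) : ℕ)) ^ j) := by
  set n := k + (j + 2)
  have hn0 : (0 : ℝ) < n := by
    rw [Nat.cast_pos]
    omega
  have hsn : 0 < √(n : ℝ) := Real.sqrt_pos.2 hn0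
  set V := EuclideanSpace ℝ (Fin n)
  set E := EuclideanSpace ℝ (Fin k)
  set F := EuclideanSpace ℝ (Fin (j + 2))
  refine ⟨((volume : Measure V).toSphere Set.univ)⁻¹ * (n * ((∫⁻ z : F in ball 0 1,
    ENNReal.ofReal (‖z‖ ^ k)) * ENNReal.ofReal ((√(n : ℝ) ^ k)⁻¹))), Measure.ext fun A hA => ?_⟩
  have hpre : MeasurableSet ((fun u : E => √(n : ℝ) • u) ⁻¹' A) := measurable_const_smul _ hA
  have hT : MeasurableSet {x : V | √(n : ℝ) • firstCoords k x ∈ A} :=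
    ((measurable_const_smul _).comp (continuous_firstCoords k n).measurable) hA
  have hcone : (volume : Measure V) {x : V | ‖x‖ < 1 ∧ ‖x‖⁻¹ • x ∈
      {x : V | √(n : ℝ) • firstCoords k x ∈ A}} =
      ∫⁻ p : E × F in {p | ‖p.1‖ ^ 2 + ‖p.2‖ ^ 2 < 1},
        ((fun u : E => √(n : ℝ) • u) ⁻¹' A).indicator 1 ((√(‖p.1‖ ^ 2 + ‖p.2‖ ^ 2))⁻¹ • p.1) := by
    have hm : MeasurableSet {p : E × F | ‖p.1‖ ^ 2 + ‖p.2‖ ^ 2 < 1} :=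
      measurableSet_lt (by fun_prop) measurable_const
    have hq : Measurable fun p : E × F => (√(‖p.1‖ ^ 2 + ‖p.2‖ ^ 2))⁻¹ • p.1 := by fun_prop
    have : {x : V | ‖x‖ < 1 ∧ ‖x‖⁻¹ • x ∈ {x : V | √(n : ℝ) • firstCoords k x ∈ A}} =
        (fun x : V => WithLp.ofLp (splitCoords k (j + 2) x)) ⁻¹'
          ((fun p : E × F => (√(‖p.1‖ ^ 2 + ‖p.2‖ ^ 2))⁻¹ • p.1) ⁻¹'
            ((fun u : E => √(n : ℝ) • u) ⁻¹' A) ∩ {p | ‖p.1‖ ^ 2 + ‖p.2‖ ^ 2 < 1}) := by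
      ext x
      simp only [Set.mem_ofPred_eq, Set.mem_preimage, Set.mem_inter_iff]
      rw [norm_eq_splitCoords k (j + 2) x, splitCoords_fst, and_comm, Real.sqrt_lt' one_pos,
        one_pow, firstCoords_smul]
    rw [this, (measurePreserving_splitCoords k (j + 2)).measure_preimage
      ((hq hpre).inter hm).nullMeasurableSet, ← Measure.restrict_apply (hq hpre),
      ← lintegral_indicator_one (hq hpre)]
    rfl
  have hscale : ∫⁻ u : E, A.indicator (fun u => ENNReal.ofReal (√(1 - ‖u‖ ^ 2 / n) ^ j)) u =
      ENNReal.ofReal (√(n : ℝ) ^ k) * ∫⁻ x : E in ball 0 1, ENNReal.ofReal (√(1 - ‖x‖ ^ 2) ^ j) *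
        ((fun u : E => √(n : ℝ) • u) ⁻¹' A).indicator 1 x := by
    rw [lintegral_eq_mul_lintegral_comp_smul hsn (Measurable.indicator (by fun_prop) hA),
      finrank_euclideanSpace_fin, ← lintegral_indicator measurableSet_ball]
    congr 1
    refine lintegral_congr fun x => ?_
    have h1 : ‖√(n : ℝ) • x‖ ^ 2 / n = ‖x‖ ^ 2 := by
      rw [norm_smul, Real.norm_of_nonneg hsn.le, mul_pow, Real.sq_sqrt hn0.le]
      field_simp
    by_cases hxA : √(n : ℝ) • x ∈ A
    · rw [Set.indicator_of_mem hxA, h1]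
      by_cases hx : x ∈ ball (0 : E) 1
      · rw [Set.indicator_of_mem hx, Set.indicator_of_mem (show x ∈ _ ⁻¹' A from hxA),
          Pi.one_apply, mul_one]
      · rw [Set.indicator_of_notMem hx, Real.sqrt_eq_zero_of_nonpos, zero_pow hj,
          ENNReal.ofReal_zero]
        have : 1 ≤ ‖x‖ := not_lt.1 (mt mem_ball_zero_iff.2 hx)
        nlinarith
    · rw [Set.indicator_of_notMem hxA]
      by_cases hx : x ∈ ball (0 : E) 1
      · rw [Set.indicator_of_mem hx, Set.indicator_of_notMem (show x ∉ _ ⁻¹' A from hxA),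
          mul_zero]
      · rw [Set.indicator_of_notMem hx]
  rw [Measure.map_apply (measurable_firstCoords_coe k n) hA, sphereMeasure,
    Measure.map_apply (measurable_dilateSphere n) (measurable_firstCoords_coe k n hA)]
  have hS : dilateSphere n ⁻¹' ((fun x : RootSphere n => firstCoords k (x : V)) ⁻¹' A) =
      {x : sphere (0 : V) 1 | (x : V) ∈ {x : V | √(n : ℝ) • firstCoords k x ∈ A}} := by
    ext x
    simp only [Set.mem_preimage, Set.mem_ofPred_eq, dilateSphere, firstCoords_smul]
  have hT' : MeasurableSet {x : sphere (0 : V) 1 | (x : V) ∈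
      {x : V | √(n : ℝ) • firstCoords k x ∈ A}} := measurable_subtype_coe hT
  rw [hS, Measure.smul_apply, Measure.toSphere_apply' _ hT',
    Ioo_smul_coe_image, measure_sdiff_null (measure_singleton _), hcone,
    setLIntegral_ball_prod_eq_setLIntegral_ball (by rw [finrank_euclideanSpace_fin])
      (measurable_one.indicator hpre), Measure.smul_apply, withDensity_apply _ hA,
    ← lintegral_indicator hA, hscale, finrank_euclideanSpace_fin, finrank_euclideanSpace_fin]
  simp only [smul_eq_mul, mul_assoc]
  congr 3
  rw [← mul_assoc (ENNReal.ofReal _), ← ENNReal.ofReal_mul (by positivity),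
    inv_mul_cancel₀ (by positivity), ENNReal.ofReal_one, one_mul]

end Sphere

/-! ### Convergence to the Gaussian measure -/

section Gaussian

theorem integral_smul_withDensity_ofReal {X : Type*} [MeasurableSpace X] (μ : Measure X)
    {h : X → ℝ} (hm : Measurable h) (h0 : ∀ x, 0 ≤ h x) (c : ENNReal) (f : X → ℝ) :
    ∫ x, f x ∂(c • μ.withDensity fun x => ENNReal.ofReal (h x)) =
      c.toReal * ∫ x, h x * f x ∂μ := by
  rw [integral_smul_measure, integral_withDensity_eq_integral_toReal_smul
    (by fun_prop) (Eventually.of_forall fun _ => ENNReal.ofReal_lt_top)]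
  simp only [ENNReal.toReal_ofReal (h0 _), smul_eq_mul]

variable (E : Type*) [NormedAddCommGroup E] [InnerProductSpace ℝ E] [FiniteDimensional ℝ E]
  [MeasurableSpace E] [BorelSpace E]

theorem integrable_exp_neg_norm_sq : Integrable fun x : E => Real.exp (-‖x‖ ^ 2 / 2) := by
  by_contra h
  have := GaussianFourier.integral_rexp_neg_mul_sq_norm (V := E) (b := 1 / 2) (by norm_num)
  rw [show (fun v : E => Real.exp (-(1 / 2) * ‖v‖ ^ 2)) = fun x : E => Real.exp (-‖x‖ ^ 2 / 2) by
    ext; ring_nf, integral_undef h] at this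
  exact (Real.rpow_pos_of_pos (by positivity) _).ne this

/-- The density of the Gaussian measure, by comparison of characteristic functions; the value of the
constant is never needed. -/
theorem exists_stdGaussian_eq_smul_withDensity : ∃ c : ENNReal, c ≠ 0 ∧ c ≠ ⊤ ∧
    stdGaussian E = c • (volume : Measure E).withDensity
      fun x => ENNReal.ofReal (Real.exp (-‖x‖ ^ 2 / 2)) := by
  set ρ := (volume : Measure E).withDensity fun x => ENNReal.ofReal (Real.exp (-‖x‖ ^ 2 / 2))
    with hρ
  have hfin : IsFiniteMeasure ρ := isFiniteMeasure_withDensity_ofReal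
    (integrable_exp_neg_norm_sq E).2
  have hρ0 : ρ Set.univ ≠ 0 := by
    intro h
    rw [hρ, Measure.measure_univ_eq_zero, withDensity_eq_zero_iff (by fun_prop)] at h
    obtain ⟨x, hx⟩ := h.exists
    exact (ENNReal.ofReal_pos.2 (Real.exp_pos _)).ne' hx
  have hchar : ∀ t, charFun ρ t = (2 * Real.pi : ℂ) ^ (Module.finrank ℝ E / 2 : ℂ) *
      Complex.exp (-‖t‖ ^ 2 / 2) := by
    intro t
    have h := GaussianFourier.integral_cexp_neg_mul_sq_norm_add (b := 1 / 2) (by norm_num)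
      Complex.I t
    rw [charFun_apply, hρ, integral_withDensity_eq_integral_toReal_smul (by fun_prop)
      (Eventually.of_forall fun _ => ENNReal.ofReal_lt_top)]
    convert h using 2
    · ext v
      rw [ENNReal.toReal_ofReal (Real.exp_pos _).le, Complex.real_smul, Complex.ofReal_exp,
        ← Complex.exp_add, real_inner_comm]
      congr 1
      push_cast
      ring
    · congr 1
      ring
    · congr 1
      rw [Complex.I_sq]
      ring
  have h1 : (ρ.real Set.univ : ℂ) = (2 * Real.pi : ℂ) ^ (Module.finrank ℝ E / 2 : ℂ) := by
    rw [← charFun_zero, hchar]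
    simp
  refine ⟨(ρ Set.univ)⁻¹, ENNReal.inv_ne_zero.2 (measure_ne_top _ _), ENNReal.inv_ne_top.2 hρ0, ?_⟩
  have : IsFiniteMeasure ((ρ Set.univ)⁻¹ • ρ) := ρ.smul_finite (ENNReal.inv_ne_top.2 hρ0)
  refine Measure.ext_of_charFun (funext fun t => ?_)
  have h2 : (ρ.real Set.univ : ℂ) ≠ 0 := by
    rw [Complex.ofReal_ne_zero, measureReal_def]
    exact ENNReal.toReal_ne_zero.2 ⟨hρ0, measure_ne_top _ _⟩
  rw [charFun_stdGaussian, charFun_apply, integral_smul_measure, ← charFun_apply, hchar, ← h1,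
    ENNReal.toReal_inv, ← measureReal_def, Complex.real_smul, Complex.ofReal_inv,
    inv_mul_cancel_left₀ h2]

end Gaussian

section Density

/-- The bound `1 - s ≤ e^{-s}`, `s = t / n`, leaves a factor `e^{s (k + 2) / 2}`, which is bounded
since `s ≤ 1` where the left side is positive. -/
theorem sqrt_one_sub_div_pow_le (k j : ℕ) (hj : j ≠ 0) (t : ℝ) :
    √(1 - t / (k + (j + 2) : ℕ)) ^ j ≤ Real.exp ((k + 2) / 2) * Real.exp (-t / 2) := by
  have hn : (0 : ℝ) < (k + (j + 2) : ℕ) := by positivity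
  set n : ℝ := ((k + (j + 2) : ℕ) : ℝ) with hn'
  have hnj : n = k + (j + 2) := by push_cast [hn']; ring
  rcases le_total t n with h | h
  · have h1 : √(1 - t / n) ≤ Real.exp (-(t / n) / 2) := by
      rw [Real.exp_half]
      exact Real.sqrt_le_sqrt (Real.one_sub_le_exp_neg _)
    calc √(1 - t / n) ^ j ≤ Real.exp (-(t / n) / 2) ^ j := by gcongr
      _ = Real.exp (t / n * ((k + 2) / 2) + -t / 2) := by
        rw [← Real.exp_nat_mul]
        congr 1
        field_simp
        rw [hnj]
        ring
      _ ≤ Real.exp ((k + 2) / 2 + -t / 2) := by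
        have : t / n ≤ 1 := (div_le_one hn).2 h
        have h2 : (0 : ℝ) ≤ (k + 2) / 2 := by positivity
        gcongr
        exact mul_le_of_le_one_left h2 this
      _ = _ := Real.exp_add _ _
  · rw [Real.sqrt_eq_zero_of_nonpos (sub_nonpos.2 ((one_le_div hn).2 h)), zero_pow hj]
    positivity

theorem tendsto_sqrt_one_sub_div_pow (k : ℕ) (t : ℝ) :
    Tendsto (fun j : ℕ => √(1 - t / (k + (j + 2) : ℕ)) ^ j) atTop (𝓝 (Real.exp (-t / 2))) := by
  have hn : Tendsto (fun j : ℕ => k + (j + 2)) atTop atTop :=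
    tendsto_atTop_mono (fun j => show j ≤ k + (j + 2) by omega) tendsto_id
  have h0 : Tendsto (fun j : ℕ => 1 - t / (k + (j + 2) : ℕ)) atTop (𝓝 1) := by
    simpa using ((tendsto_const_div_atTop_nhds_zero_nat t).comp hn).const_sub 1
  have h1 : Tendsto (fun j : ℕ => √((1 + -t / (k + (j + 2) : ℕ)) ^ (k + (j + 2)))) atTop
      (𝓝 (Real.exp (-t / 2))) := by
    rw [Real.exp_half]
    exact ((Real.tendsto_one_add_div_pow_exp (-t)).comp hn).sqrt
  have h2 : Tendsto (fun j : ℕ => √(1 - t / (k + (j + 2) : ℕ)) ^ (k + 2)) atTop (𝓝 1) := by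
    simpa using h0.sqrt.pow (k + 2)
  have h3 := h1.div h2 one_ne_zero
  rw [div_one] at h3
  refine h3.congr' ?_
  filter_upwards [h0.eventually (lt_mem_nhds one_pos)] with j hj
  have hs : 0 < √(1 - t / (k + (j + 2) : ℕ)) := Real.sqrt_pos.2 hj
  rw [Pi.div_apply, neg_div, ← sub_eq_add_neg, div_eq_iff (by positivity), ← pow_add]
  rw [show √((1 - t / (k + (j + 2) : ℕ)) ^ (k + (j + 2))) =
    √(1 - t / (k + (j + 2) : ℕ)) ^ (k + (j + 2)) by
      rw [Real.sqrt_eq_iff_eq_sq (by positivity) (by positivity), ← pow_mul, mul_comm, pow_mul,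
        Real.sq_sqrt hj.le]]
  congr 1
  ring

end Density

section Limit

variable (k : ℕ)

/-- The law of the first `k` coordinates on `S^{n-1}(√n)`. -/
noncomputable def coordsLaw (n : ℕ) : Measure (EuclideanSpace ℝ (Fin k)) :=
  (sphereMeasure n).map fun x : RootSphere n => firstCoords k x.1

theorem isProbabilityMeasure_coordsLaw {n : ℕ} (hn : n ≠ 0) :
    IsProbabilityMeasure (coordsLaw k n) := by
  have := isProbabilityMeasure_sphereMeasure hn
  exact Measure.isProbabilityMeasure_map (measurable_firstCoords_coe k n).aemeasurable

/-- Dominated convergence for the unnormalized densities. -/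
theorem tendsto_integral_sqrt_pow_mul {f : EuclideanSpace ℝ (Fin k) → ℝ}
    (hf : Integrable fun x => Real.exp (-‖x‖ ^ 2 / 2) * f x) :
    Tendsto (fun j : ℕ => ∫ x, √(1 - ‖x‖ ^ 2 / (k + (j + 2) : ℕ)) ^ j * f x) atTop
      (𝓝 (∫ x, Real.exp (-‖x‖ ^ 2 / 2) * f x)) := by
  have hfm : AEStronglyMeasurable f := by
    have h : AEStronglyMeasurable fun x : EuclideanSpace ℝ (Fin k) =>
        (Real.exp (-‖x‖ ^ 2 / 2))⁻¹ * (Real.exp (-‖x‖ ^ 2 / 2) * f x) :=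
      AEStronglyMeasurable.mul (Measurable.aestronglyMeasurable (by fun_prop)) hf.1
    simpa only [inv_mul_cancel_left₀ (Real.exp_ne_zero _)] using h
  refine tendsto_integral_filter_of_dominated_convergence
    (fun x => Real.exp ((k + 2) / 2) * ‖Real.exp (-‖x‖ ^ 2 / 2) * f x‖) ?_ ?_
    (hf.norm.const_mul _) ?_
  · exact Eventually.of_forall fun j =>
      AEStronglyMeasurable.mul (Measurable.aestronglyMeasurable (by fun_prop)) hfm
  · filter_upwards [eventually_ne_atTop 0] with j hj
    refine Eventually.of_forall fun x => ?_
    rw [norm_mul, norm_mul, Real.norm_of_nonneg (by positivity), Real.norm_of_nonneg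
      (Real.exp_pos _).le, ← mul_assoc]
    gcongr
    exact sqrt_one_sub_div_pow_le k j hj _
  · exact Eventually.of_forall fun x => (tendsto_sqrt_one_sub_div_pow k (‖x‖ ^ 2)).mul_const _

/-- The normalizing constants of the laws converge, as the total masses are `1`. -/
theorem exists_coordsLaw_eq : ∃ c : ℕ → ENNReal,
    (∀ j, j ≠ 0 → coordsLaw k (k + (j + 2)) = c j •
      (volume : Measure (EuclideanSpace ℝ (Fin k))).withDensity fun u =>
        ENNReal.ofReal (√(1 - ‖u‖ ^ 2 / (k + (j + 2) : ℕ)) ^ j)) ∧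
    (∀ j, j ≠ 0 → c j ≠ ⊤) ∧
    Tendsto (fun j => (c j).toReal) atTop
      (𝓝 (∫ x : EuclideanSpace ℝ (Fin k), Real.exp (-‖x‖ ^ 2 / 2))⁻¹) := by
  have h : ∀ j, ∃ c : ENNReal, j ≠ 0 → coordsLaw k (k + (j + 2)) = c •
      (volume : Measure (EuclideanSpace ℝ (Fin k))).withDensity fun u =>
        ENNReal.ofReal (√(1 - ‖u‖ ^ 2 / (k + (j + 2) : ℕ)) ^ j) := by
    intro j
    by_cases hj : j = 0
    · exact ⟨0, fun h => absurd hj h⟩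
    · obtain ⟨c, hc⟩ := exists_map_firstCoords_sphereMeasure k hj
      exact ⟨c, fun _ => hc⟩
  choose c hc using h
  have hone : ∀ j, j ≠ 0 →
      (c j).toReal * ∫ x : EuclideanSpace ℝ (Fin k), √(1 - ‖x‖ ^ 2 / (k + (j + 2) : ℕ)) ^ j = 1 := by
    intro j hj
    have := isProbabilityMeasure_coordsLaw k (n := k + (j + 2)) (by omega)
    have h1 : ∫ _x, (1 : ℝ) ∂(coordsLaw k (k + (j + 2))) = 1 := by simp
    rw [hc j hj, integral_smul_withDensity_ofReal _ (by fun_prop) (fun _ => by positivity)] at h1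
    simpa only [mul_one] using h1
  refine ⟨c, hc, fun j hj h => ?_, ?_⟩
  · have := hone j hj
    rw [h, ENNReal.toReal_top, zero_mul] at this
    exact zero_ne_one this
  · have hlim := tendsto_integral_sqrt_pow_mul k (f := fun _ => 1)
      (by simpa using integrable_exp_neg_norm_sq (EuclideanSpace ℝ (Fin k)))
    simp only [mul_one] at hlim
    refine (hlim.inv₀ (integral_exp_pos (integrable_exp_neg_norm_sq _)).ne').congr' ?_
    filter_upwards [eventually_ne_atTop 0] with j hj
    exact (eq_inv_of_mul_eq_one_left (hone j hj)).symm

/-- The Gaussian measure dominates the laws of the first `k` coordinates, up to a constant. -/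
theorem exists_coordsLaw_le : ∃ C : ENNReal, C ≠ ⊤ ∧ ∀ᶠ n in atTop,
    coordsLaw k n ≤ C • stdGaussian (EuclideanSpace ℝ (Fin k)) := by
  obtain ⟨c, hc, hct, hlim⟩ := exists_coordsLaw_eq k
  obtain ⟨a, ha0, hat, ha⟩ := exists_stdGaussian_eq_smul_withDensity (EuclideanSpace ℝ (Fin k))
  set Z := (∫ x : EuclideanSpace ℝ (Fin k), Real.exp (-‖x‖ ^ 2 / 2))⁻¹
  set K := Real.exp ((k + 2) / 2)
  refine ⟨ENNReal.ofReal (Z + 1) * ENNReal.ofReal K * a⁻¹,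
    ENNReal.mul_ne_top (ENNReal.mul_ne_top ENNReal.ofReal_ne_top ENNReal.ofReal_ne_top)
      (ENNReal.inv_ne_top.2 ha0), ?_⟩
  rw [← map_add_atTop_eq_nat (k + 2), eventually_map]
  filter_upwards [eventually_ne_atTop 0, hlim.eventually (gt_mem_nhds (lt_add_one Z))]
    with j hj hcj
  rw [show j + (k + 2) = k + (j + 2) by ring, hc j hj, ha, smul_smul, mul_assoc, mul_assoc,
    ENNReal.inv_mul_cancel ha0 hat, mul_one, ← smul_smul]
  have h1 : c j ≤ ENNReal.ofReal (Z + 1) := by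
    rw [← ENNReal.ofReal_toReal (hct j hj)]
    exact ENNReal.ofReal_le_ofReal hcj.le
  have h2 : (volume : Measure (EuclideanSpace ℝ (Fin k))).withDensity (fun u =>
      ENNReal.ofReal (√(1 - ‖u‖ ^ 2 / (k + (j + 2) : ℕ)) ^ j)) ≤
      ENNReal.ofReal K • (volume : Measure (EuclideanSpace ℝ (Fin k))).withDensity
        fun x => ENNReal.ofReal (Real.exp (-‖x‖ ^ 2 / 2)) := by
    rw [← withDensity_smul _ (by fun_prop)]
    refine withDensity_mono (Eventually.of_forall fun x => ?_)
    rw [Pi.smul_apply, smul_eq_mul, ← ENNReal.ofReal_mul (Real.exp_pos _).le]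
    exact ENNReal.ofReal_le_ofReal (sqrt_one_sub_div_pow_le k j hj _)
  exact Measure.le_iff'.2 fun s => mul_le_mul' h1 (h2 s)

theorem tendsto_integral_coordsLaw {f : EuclideanSpace ℝ (Fin k) → ℝ}
    (hf : Integrable f (stdGaussian (EuclideanSpace ℝ (Fin k)))) :
    Tendsto (fun n => ∫ x, f x ∂(coordsLaw k n)) atTop
      (𝓝 (∫ x, f x ∂(stdGaussian (EuclideanSpace ℝ (Fin k))))) := by
  obtain ⟨c, hc, -, hlim⟩ := exists_coordsLaw_eq k
  obtain ⟨a, ha0, hat, ha⟩ := exists_stdGaussian_eq_smul_withDensity (EuclideanSpace ℝ (Fin k))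
  have haZ : a.toReal = (∫ x : EuclideanSpace ℝ (Fin k), Real.exp (-‖x‖ ^ 2 / 2))⁻¹ := by
    have h1 : ∫ _x, (1 : ℝ) ∂(stdGaussian (EuclideanSpace ℝ (Fin k))) = 1 := by simp
    rw [ha, integral_smul_withDensity_ofReal _ (by fun_prop) (fun _ => by positivity)] at h1
    simp only [mul_one] at h1
    exact eq_inv_of_mul_eq_one_left h1
  have hfi : Integrable fun x => Real.exp (-‖x‖ ^ 2 / 2) * f x := by
    rw [ha, integrable_smul_measure ha0 hat, integrable_withDensity_iff_integrable_smul'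
      (by fun_prop) (Eventually.of_forall fun _ => ENNReal.ofReal_lt_top)] at hf
    simpa only [ENNReal.toReal_ofReal (Real.exp_pos _).le, smul_eq_mul] using hf
  rw [← tendsto_add_atTop_iff_nat (k + 2), ha,
    integral_smul_withDensity_ofReal _ (by fun_prop) (fun _ => by positivity), haZ]
  refine (hlim.mul (tendsto_integral_sqrt_pow_mul k hfi)).congr' ?_
  filter_upwards [eventually_ne_atTop 0] with j hj
  rw [show j + (k + 2) = k + (j + 2) by ring, hc j hj,
    integral_smul_withDensity_ofReal _ (by fun_prop) (fun _ => by positivity)]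

end Limit

/-! ### Functions of the first coordinates -/

section OnSphere

variable {k : ℕ} {f : EuclideanSpace ℝ (Fin k) → ℝ}

theorem eventually_isProbabilityMeasure_sphereMeasure :
    ∀ᶠ n in atTop, IsProbabilityMeasure (sphereMeasure n) :=
  (eventually_ne_atTop 0).mono fun _ h => isProbabilityMeasure_sphereMeasure h

theorem eventually_coordsLaw_absolutelyContinuous (k : ℕ) :
    ∀ᶠ n in atTop, coordsLaw k n ≪ stdGaussian (EuclideanSpace ℝ (Fin k)) := by
  obtain ⟨C, -, h⟩ := exists_coordsLaw_le k
  exact h.mono fun n hn => (Measure.absolutelyContinuous_of_le hn).trans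
    Measure.smul_absolutelyContinuous

theorem eventually_integrable_coordsLaw (hf : Integrable f (stdGaussian (EuclideanSpace ℝ (Fin k)))) :
    ∀ᶠ n in atTop, Integrable f (coordsLaw k n) := by
  obtain ⟨C, hC, h⟩ := exists_coordsLaw_le k
  exact h.mono fun n hn => (hf.smul_measure hC).mono_measure hn

theorem eventually_integrable_onSphere (hf : Integrable f (stdGaussian (EuclideanSpace ℝ (Fin k)))) :
    ∀ᶠ n in atTop, Integrable (onSphere f n) (sphereMeasure n) := by
  filter_upwards [eventually_integrable_coordsLaw hf] with n hn
  exact (integrable_map_measure hn.1 (measurable_firstCoords_coe k n).aemeasurable).1 hn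

theorem tendsto_integral_onSphere (hf : Integrable f (stdGaussian (EuclideanSpace ℝ (Fin k)))) :
    Tendsto (fun n => ∫ x, onSphere f n x ∂(sphereMeasure n)) atTop
      (𝓝 (∫ x, f x ∂(stdGaussian (EuclideanSpace ℝ (Fin k))))) := by
  refine (tendsto_integral_coordsLaw k hf).congr' ?_
  filter_upwards [eventually_integrable_coordsLaw hf] with n hn
  exact integral_map (measurable_firstCoords_coe k n).aemeasurable hn.1

/-- The truncated function `|f| 1_{|f| ≥ m}`. -/
noncomputable def tailPart (f : EuclideanSpace ℝ (Fin k) → ℝ) (m : ℕ)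
    (x : EuclideanSpace ℝ (Fin k)) : ℝ :=
  {x | (m : ℝ) ≤ |f x|}.indicator (fun x => |f x|) x

theorem tailPart_nonneg (m : ℕ) (x : EuclideanSpace ℝ (Fin k)) : 0 ≤ tailPart f m x :=
  Set.indicator_nonneg (fun _ _ => abs_nonneg _) _

theorem tailPart_le (m : ℕ) (x : EuclideanSpace ℝ (Fin k)) : tailPart f m x ≤ |f x| :=
  Set.indicator_le_self' (fun _ _ => abs_nonneg _) _

theorem abs_le_add_tailPart (m : ℕ) (x : EuclideanSpace ℝ (Fin k)) :
    |f x| ≤ m + tailPart f m x := by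
  by_cases h : (m : ℝ) ≤ |f x|
  · rw [tailPart, Set.indicator_of_mem (show x ∈ {x | (m : ℝ) ≤ |f x|} from h)]
    linarith [(Nat.cast_nonneg m : (0 : ℝ) ≤ m)]
  · linarith [tailPart_nonneg (f := f) m x]

theorem integrable_tailPart (hf : Integrable f (stdGaussian (EuclideanSpace ℝ (Fin k)))) (m : ℕ) :
    Integrable (tailPart f m) (stdGaussian (EuclideanSpace ℝ (Fin k))) :=
  hf.abs.indicator₀ (nullMeasurableSet_le aemeasurable_const hf.abs.1.aemeasurable)

theorem tendsto_integral_tailPart (hf : Integrable f (stdGaussian (EuclideanSpace ℝ (Fin k)))) :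
    Tendsto (fun m : ℕ => ∫ x, tailPart f m x ∂(stdGaussian (EuclideanSpace ℝ (Fin k)))) atTop
      (𝓝 0) := by
  have h := tendsto_integral_of_dominated_convergence
    (μ := stdGaussian (EuclideanSpace ℝ (Fin k))) (F := tailPart f) (f := fun _ => 0)
    (fun x => |f x|) (fun m => (integrable_tailPart hf m).1) hf.abs
    (fun m => Eventually.of_forall fun x => by
      rw [Real.norm_of_nonneg (tailPart_nonneg m x)]
      exact tailPart_le m x)
    (Eventually.of_forall fun x => by
      refine tendsto_const_nhds.congr' ?_
      obtain ⟨m₀, hm₀⟩ := exists_nat_gt |f x|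
      filter_upwards [eventually_ge_atTop m₀] with m hm
      have h : x ∉ {x | (m : ℝ) ≤ |f x|} := (hm₀.trans_le (Nat.cast_le.2 hm)).not_ge
      exact (Set.indicator_of_notMem h _).symm)
  simpa using h

theorem tendsto_setIntegral_abs_onSphere
    (hf : Integrable f (stdGaussian (EuclideanSpace ℝ (Fin k)))) (m : ℕ) :
    Tendsto (fun n : ℕ => ∫ x in {x | (m : ℝ) ≤ |onSphere f n x|}, |onSphere f n x|
      ∂(sphereMeasure n)) atTop (𝓝 (∫ x, tailPart f m x ∂(stdGaussian (EuclideanSpace ℝ (Fin k))))) := by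
  refine (tendsto_integral_onSphere (integrable_tailPart hf m)).congr' ?_
  filter_upwards [eventually_integrable_onSphere hf] with n hn
  rw [← integral_indicator₀
    (nullMeasurableSet_le aemeasurable_const hn.abs.1.aemeasurable)]
  rfl

/-- Uniform integrability of `f` on the spheres. -/
theorem exists_pos_setIntegral_abs_onSphere_lt
    (hf : Integrable f (stdGaussian (EuclideanSpace ℝ (Fin k)))) {ε : ℝ} (hε : 0 < ε) :
    ∃ δ > 0, ∀ᶠ n in atTop, ∀ B, MeasurableSet B → (sphereMeasure n).real B < δ →
      ∫ x in B, |onSphere f n x| ∂(sphereMeasure n) < ε := by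
  obtain ⟨m, hm⟩ := ((tendsto_integral_tailPart hf).eventually
    (gt_mem_nhds (half_pos hε))).exists
  refine ⟨ε / 2 / (m + 1), by positivity, ?_⟩
  filter_upwards [(tendsto_integral_onSphere (integrable_tailPart hf m)).eventually
    (gt_mem_nhds hm), eventually_integrable_onSphere hf,
    eventually_integrable_onSphere (integrable_tailPart hf m),
    eventually_isProbabilityMeasure_sphereMeasure] with n hn hfi hti hprob B hB hδ
  rw [lt_div_iff₀ (by positivity)] at hδ
  have h0 : 0 ≤ (sphereMeasure n).real B := measureReal_nonneg
  calc ∫ x in B, |onSphere f n x| ∂(sphereMeasure n)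
      ≤ ∫ x in B, ((m : ℝ) + onSphere (tailPart f m) n x) ∂(sphereMeasure n) :=
        integral_mono hfi.abs.integrableOn
          ((integrable_const _).add hti).integrableOn fun x => abs_le_add_tailPart m _
    _ = (sphereMeasure n).real B * m + ∫ x in B, onSphere (tailPart f m) n x ∂(sphereMeasure n) := by
        rw [integral_add (integrable_const _) hti.integrableOn, setIntegral_const, smul_eq_mul]
    _ ≤ (sphereMeasure n).real B * m + ∫ x, onSphere (tailPart f m) n x ∂(sphereMeasure n) :=
        add_le_add_right (setIntegral_le_integral hti
          (Eventually.of_forall fun x => tailPart_nonneg m _)) _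
    _ < ε := by nlinarith

/-- The laws of `f` on the spheres converge on every Borel set. -/
theorem tendsto_measureReal_preimage_onSphere (hf : Measurable f) {S : Set ℝ}
    (hS : MeasurableSet S) :
    Tendsto (fun n => (sphereMeasure n).real (onSphere f n ⁻¹' S)) atTop
      (𝓝 ((Measure.map f (stdGaussian (EuclideanSpace ℝ (Fin k)))).real S)) := by
  have h := tendsto_integral_coordsLaw k (f := (f ⁻¹' S).indicator 1)
    ((integrable_const (1 : ℝ)).indicator (hf hS))
  rw [integral_indicator_one (hf hS)] at h
  rw [map_measureReal_apply hf hS]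
  refine h.congr fun n => ?_
  rw [integral_indicator_one (hf hS), coordsLaw,
    map_measureReal_apply (measurable_firstCoords_coe k n) (hf hS)]
  rfl

end OnSphere

section Loeb

variable {k : ℕ} {f : EuclideanSpace ℝ (Fin k) → ℝ} (𝔘 : NonstandardExtension.{u})
  {N : 𝔘.star ℕ}

instance : Nonempty (Σ n, RootSphere n) := ⟨⟨0, 0, by simp⟩⟩

namespace NonstandardExtension

theorem ae_starFun_onSphere_eq (hN : 𝔘.IsHyperfinite N) {g : EuclideanSpace ℝ (Fin k) → ℝ}
    (h : f =ᵐ[stdGaussian (EuclideanSpace ℝ (Fin k))] g) :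
    ∀ᵐ x ∂(𝔘.loebMeasure sphereMeasure N),
      𝔘.starFun sphereMeasure N (onSphere f) x = 𝔘.starFun sphereMeasure N (onSphere g) x := by
  have hle := IsHyperfinite.typ_le 𝔘 hN
  refine ae_starFun_eq 𝔘 (hle eventually_isProbabilityMeasure_sphereMeasure) (hle ?_)
  filter_upwards [eventually_coordsLaw_absolutelyContinuous k] with n hn
  exact ae_of_ae_map (measurable_firstCoords_coe k n).aemeasurable (hn.ae_le h)

theorem sIntegrable_onSphere (h𝔘 : 𝔘.IsSaturated (Cardinal.aleph 1)) (hN : 𝔘.IsHyperfinite N)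
    (hf : Integrable f (stdGaussian (EuclideanSpace ℝ (Fin k)))) :
    𝔘.SIntegrable sphereMeasure N (onSphere f) := by
  have hle := IsHyperfinite.typ_le 𝔘 hN
  obtain ⟨g, hg, hfg⟩ := hf.1.aemeasurable
  have : IsProbabilityMeasure (Measure.map g (stdGaussian (EuclideanSpace ℝ (Fin k)))) :=
    Measure.isProbabilityMeasure_map hg.aemeasurable
  refine SIntegrable.of_eventually 𝔘 (hle (eventually_integrable_onSphere hf)) ?_
    (hle (((tendsto_integral_onSphere hf.abs).eventually (gt_mem_nhds (lt_add_one _))).mono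
      fun n hn => le_of_lt hn)) fun ε hε => ?_
  · filter_upwards [ae_starFun_onSphere_eq 𝔘 hN hfg, ae_isFinite_starFun 𝔘
      (f := onSphere g) (fun n => hg.comp (measurable_firstCoords_coe k n)) h𝔘
      (hle eventually_isProbabilityMeasure_sphereMeasure)
      fun S hS => (tendsto_measureReal_preimage_onSphere hg hS).mono_left hle] with x hx hx'
    rwa [hx]
  · obtain ⟨δ, hδ, h⟩ := exists_pos_setIntegral_abs_onSphere_lt hf hε
    exact ⟨δ, hδ, hle h⟩

theorem integrable_st_onSphere_and_integral_eq (h𝔘 : 𝔘.IsSaturated (Cardinal.aleph 1))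
    (hN : 𝔘.IsHyperfinite N) (hf : Integrable f (stdGaussian (EuclideanSpace ℝ (Fin k)))) :
    Integrable (fun x => 𝔘.st (𝔘.starFun sphereMeasure N (onSphere f) x))
        (𝔘.loebMeasure sphereMeasure N) ∧
      ∫ x, 𝔘.st (𝔘.starFun sphereMeasure N (onSphere f) x) ∂(𝔘.loebMeasure sphereMeasure N) =
        ∫ x, f x ∂(stdGaussian (EuclideanSpace ℝ (Fin k))) := by
  have hle := IsHyperfinite.typ_le 𝔘 hN
  obtain ⟨g, hg, hfg⟩ := hf.1.aemeasurable
  have : IsProbabilityMeasure (Measure.map g (stdGaussian (EuclideanSpace ℝ (Fin k)))) :=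
    Measure.isProbabilityMeasure_map hg.aemeasurable
  have hgm : ∀ n, Measurable (onSphere g n) := fun n => hg.comp (measurable_firstCoords_coe k n)
  have hν := hle eventually_isProbabilityMeasure_sphereMeasure
  have hst : (fun x => 𝔘.st (𝔘.starFun sphereMeasure N (onSphere f) x))
      =ᵐ[𝔘.loebMeasure sphereMeasure N]
      fun x => 𝔘.st (𝔘.starFun sphereMeasure N (onSphere g) x) :=
    (ae_starFun_onSphere_eq 𝔘 hN hfg).mono fun x hx => by simp only [hx]
  have hm : Measurable fun x => 𝔘.st (𝔘.starFun sphereMeasure N (onSphere g) x) :=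
    measurable_st_starFun 𝔘 hgm hν
  have hmap := map_st_starFun 𝔘 hgm h𝔘 hν
    fun S hS => (tendsto_measureReal_preimage_onSphere hg hS).mono_left hle
  constructor
  · rw [integrable_congr hst]
    have h : Integrable id (Measure.map g (stdGaussian (EuclideanSpace ℝ (Fin k)))) :=
      (integrable_map_measure aestronglyMeasurable_id hg.aemeasurable).2
        ((integrable_congr hfg).1 hf)
    rw [← hmap] at h
    exact (integrable_map_measure aestronglyMeasurable_id hm.aemeasurable).1 h
  · rw [integral_congr_ae hst, integral_congr_ae hfg,
      ← integral_map (f := fun y : ℝ => y) hg.aemeasurable aestronglyMeasurable_id, ← hmap,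
      integral_map (f := fun y : ℝ => y) hm.aemeasurable aestronglyMeasurable_id]

end NonstandardExtension

end Loeb

theorem mainTheorem1 (k : ℕ) (p : ℝ) (hp : 1 < p) (f : EuclideanSpace ℝ (Fin k) → ℝ)
    (hf : MemLp f (ENNReal.ofReal p) (stdGaussian (EuclideanSpace ℝ (Fin k)))) :
    (∀ 𝔘 : NonstandardExtension.{u}, 𝔘.IsSaturated (Cardinal.aleph 1) →
      ∀ N : 𝔘.star ℕ, 𝔘.IsHyperfinite N → 𝔘.SIntegrable sphereMeasure N (onSphere f)) ∧
    (∀ᶠ n : ℕ in atTop, Integrable (onSphere f n) (sphereMeasure n)) ∧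
    (∃ L : ℕ → ℝ,
      (∀ m : ℕ, Tendsto
        (fun n : ℕ => ∫ x in {x | (m : ℝ) ≤ |onSphere f n x|}, |onSphere f n x| ∂(sphereMeasure n))
        atTop (𝓝 (L m))) ∧
      Tendsto L atTop (𝓝 0)) ∧
    Tendsto (fun n : ℕ => ∫ x, onSphere f n x ∂(sphereMeasure n)) atTop
      (𝓝 (∫ x, f x ∂(stdGaussian (EuclideanSpace ℝ (Fin k))))) ∧
    (∀ 𝔘 : NonstandardExtension.{u}, 𝔘.IsSaturated (Cardinal.aleph 1) →
      ∀ N : 𝔘.star ℕ, 𝔘.IsHyperfinite N →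
        Integrable (fun x => 𝔘.st (𝔘.starFun sphereMeasure N (onSphere f) x))
          (𝔘.loebMeasure sphereMeasure N) ∧
        ∫ x, 𝔘.st (𝔘.starFun sphereMeasure N (onSphere f) x) ∂(𝔘.loebMeasure sphereMeasure N) =
          ∫ x, f x ∂(stdGaussian (EuclideanSpace ℝ (Fin k)))) := by
  have hfi : Integrable f (stdGaussian (EuclideanSpace ℝ (Fin k))) :=
    hf.integrable (ENNReal.one_le_ofReal.2 hp.le)
  exact ⟨fun 𝔘 h𝔘 N hN => 𝔘.sIntegrable_onSphere h𝔘 hN hfi, eventually_integrable_onSphere hfi,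
    ⟨_, tendsto_setIntegral_abs_onSphere hfi, tendsto_integral_tailPart hfi⟩,
    tendsto_integral_onSphere hfi,
    fun 𝔘 h𝔘 N hN => 𝔘.integrable_st_onSphere_and_integral_eq h𝔘 hN hfi⟩
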